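/- A dimer is a finite bipartite graph without isolated nodes (multiple edges allowed, nodes coloured white and black) embedded in the oriented torus $T^2=\mathbb R^2/\mathbb Z^2$. Its zigzag paths are the oriented closed paths that, after each edge, turn to the next edge counterclockwise around a white node and clockwise around a black node; each has a winding number in $\mathbb Z^2$. Draw each zigzag path as a curve that crosses the edges it uses, so that at a node of valence $n$ it passes between two consecutive edges; thus $n$ strands of zigzag paths surround the node, and two strands cross on each edge. The dimer is properly ordered if at every node the windings of the strands are nonzero with pairwise different directions, the counterclockwise order of the strands around the node is the circular order of the directions of their windings, and the two zigzag strands crossing on any edge have different winding directions (so there is no node of valence one). For a ray $\mathcal R$ from the origin whose direction is not that of the winding of any zigzag path, let $M(\mathcal R)$ be the set of the following edges $e(v)$, one for each node $v$: $e(v)$ is the edge at $v$ such that, among all zigzag strands around $v$, the one just before $e(v)$ in counterclockwise order around $v$ has the winding with the smallest clockwise angle from $\mathcal R$, and the one just after $e(v)$ the winding with the smallest counterclockwise angle from $\mathcal R$. Let $\gamma_w,\gamma_z$ be closed curves in general position to the graph whose windings $\mathbf u,\mathbf v\in\mathbb Z^2$ form a basis of $\mathbb Z^2$, and put $\epsilon=\det(\mathbf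 u,\mathbf v)=\pm1$. The weight of an edge $e$ is $c_e w^a z^b$, where $c_e\in\mathbb C\setminus\{0\}$ is arbitrary, $a$ is the number of times $\gamma_w$ crosses $e$ with the white endpoint of $e$ on its left minus the number of times with the white endpoint on its right, and $b$ is defined likewise with $\gamma_z$. The Kasteleyn matrix has rows indexed by white nodes and columns by black nodes; each entry is the sum of the weights of the edges joining the two nodes. The toric diagram is the Newton polygon (the convex hull of the exponents of the monomials with nonzero coefficient) of its determinant. The position $P(M)\in\mathbb Z^2$ of a perfect matching $M$ is the sum of the exponents $(a,b)$ of its edges. Proposition. Let a properly ordered dimer be given. For every ray $\mathcal R$ as above, $M(\mathcal R)$ is a perfect matching; in particular there are as many white as black nodes. For every choice of $\gamma_w,\gamma_z$ and of the coefficients $c_e\neq0$: 1. the set of corners (extreme points) of the toric diagram is exactly the set of the points $P(M(\mathcal R))$, and the toric diagram is the convex hull of these points; 2. $P(M(\mathcal R))\ne P(M(\mathcal R'))$ if and only if both the open sector going counterclockwise from $\mathcal R$ to $\mathcal R'$ and the one going counterclockwise from $\mathcal R'$ to $\mathcal R$ contain the winding direction of some zigzag path; 3. the corners have the same cyclic order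 around the boundary as the rays: if $\mathcal R_1,\mathcal R_2,\mathcal R_3$ are in counterclockwise circular order and the corners $P_i=P(M(\mathcal R_i))$ are pairwise different, then $P_1,P_2,P_3$ are in counterclockwise order (strictly: $\det(P_2-P_1,P_3-P_1)>0$) if $\epsilon=1$, and in clockwise order ($\det(P_2-P_1,P_3-P_1)<0$) if $\epsilon=-1$. -/

import Mathlib

/-- A finite bipartite ribbon graph without isolated nodes, given by its set `E` of edges.
The white nodes are the cycles of `rotW`, which sends an edge to the next edge counterclockwise
around its white endpoint; the black nodes are the cycles of `rotB`, which does the same around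
the black endpoint.  The graph is mapped to the torus `ℝ² / ℤ²`: a lift to `ℝ²` of every node is
chosen, and `disp e` is the lattice vector by which the lift of `e` starting at the chosen lift
of its white endpoint misses the chosen lift of its black endpoint. -/
structure RibbonGraph (E : Type*) where
  rotW : Equiv.Perm E
  rotB : Equiv.Perm E
  disp : E → ℤ × ℤ

/-- `(a, b) ∧ (c, d) = a d - b c`. -/
def wedge {R : Type*} [Ring R] (p q : R × R) : R := p.1 * q.2 - p.2 * q.1

/-- The direction of a plane vector, as an angle modulo `2π`. -/
noncomputable def direction (r : ℝ × ℝ) : Real.Angle := ((Complex.mk r.1 r.2).arg : Real.Angle)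

/-- A lattice vector as a vector of the plane. -/
def toPlane (p : ℤ × ℤ) : ℝ × ℝ := ((p.1 : ℝ), (p.2 : ℝ))

namespace RibbonGraph

variable {E : Type*} (G : RibbonGraph E)

/-- The white nodes. -/
abbrev White : Type _ := Quotient (Equiv.Perm.SameCycle.setoid G.rotW)

/-- The black nodes. -/
abbrev Black : Type _ := Quotient (Equiv.Perm.SameCycle.setoid G.rotB)

/-- The white endpoint of an edge. -/
def white (e : E) : G.White := Quotient.mk _ e

/-- The black endpoint of an edge. -/
def black (e : E) : G.Black := Quotient.mk _ e

/-- Walk along the boundary of a face with the face on the left, traverse `e` from white to black,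
turn at the black node, traverse the next edge from black to white, and turn at the white node;
`faceStep e` is the edge that is traversed next. -/
def faceStep : Equiv.Perm E := G.rotW⁻¹ * G.rotB⁻¹

/-- The faces of the ribbon graph. -/
abbrev Face : Type _ := Quotient (Equiv.Perm.SameCycle.setoid G.faceStep)

/-- The ribbon graph, with the given displacements, is the 1-skeleton of a cell decomposition of
the oriented torus `ℝ² / ℤ²`: gluing a disc to every face gives a connected closed surface of Euler
characteristic `0`, and the map to the torus extends over the discs to a map of degree `1`.

Here `r e` is the position of the lifted centre of the face to the left of `e` (seen from white to
black), relative to the lift of the white endpoint of `e`; the first condition on `r` says that this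
position is consistent around the face.  The vector from the lift of the centre of the
face to the right of `e` to that of the face to the left is `r e - (r (rotB e) - disp (rotB e) +
disp e)`, and its wedge with `disp e` is twice the signed area of the quadrilateral (white end, right
centre, black end, left centre) of `e`.  The areas of these quadrilaterals, of which the surface
consists, add up to the degree times the area `1` of the torus. -/
def IsCellular [Fintype E] : Prop :=
  (∀ e f : E, ∃ g ∈ Subgroup.closure {G.rotW, G.rotB}, g e = f) ∧
  Nat.card G.White + Nat.card G.Black + Nat.card G.Face = Nat.card E ∧
  ∃ r : E → ℤ × ℤ,
    (∀ e, r (G.faceStep e) = r e - (G.disp e - G.disp (G.rotB⁻¹ e))) ∧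
    ∑ e, wedge (G.disp e) (r e - (r (G.rotB e) - G.disp (G.rotB e) + G.disp e)) = 2

/-- The ribbon graph, with the given displacements, is embedded in the oriented torus, its faces
being arbitrary.  Since every bipartite graph embedded in the torus can be completed to a cellularly
embedded one by drawing more nodes and edges, this says: the graph is a subgraph (`ι` on edges) of a
cellularly embedded bipartite graph `H`, and the next edge around a node is the first edge of
the subgraph that one meets when turning counterclockwise around that node in `H`. -/
def IsToroidal : Prop :=
  ∃ (N : ℕ) (H : RibbonGraph (Fin N)) (ι : E ↪ Fin N), H.IsCellular ∧
    (∀ e, G.disp e = H.disp (ι e)) ∧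
    (∀ e, ∃ n : ℕ, 0 < n ∧ (H.rotW ^ n) (ι e) = ι (G.rotW e) ∧
      ∀ m : ℕ, 0 < m → m < n → (H.rotW ^ m) (ι e) ∉ Set.range ι) ∧
    (∀ e, ∃ n : ℕ, 0 < n ∧ (H.rotB ^ n) (ι e) = ι (G.rotB e) ∧
      ∀ m : ℕ, 0 < m → m < n → (H.rotB ^ m) (ι e) ∉ Set.range ι)

end RibbonGraph

/-- A dimer model: a finite bipartite graph (without isolated nodes) embedded in the torus. -/
structure Dimer (E : Type*) extends RibbonGraph E where
  toroidal : toRibbonGraph.IsToroidal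

namespace Dimer

variable {E : Type*} (D : Dimer E)

noncomputable instance [Finite E] : Fintype D.White := Fintype.ofFinite _

noncomputable instance [Finite E] : Fintype D.Black := Fintype.ofFinite _

/-- A zigzag path comes along `e` from black to white, turns at the white node counterclockwise to
the next edge `rotW e`, traverses it from white to black, turns at the black node clockwise to the
next edge `rotB⁻¹ (rotW e)`, and traverses that one from black to white.  The zigzag paths are the
cycles of `zigzagStep`; the one that traverses `e` from black to white is the cycle of `e`, the one
that traverses `e` from white to black is the cycle of `rotW⁻¹ e`.

In the zigzag path diagram, the path that is the cycle of `e` passes the white end of `e` between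
`e` and `rotW e`, and the black end of `e` between `e` and `rotB e`: so at either end it is the path
that comes just after `e` in counterclockwise order. -/
def zigzagStep : Equiv.Perm E := D.rotB⁻¹ * D.rotW

open Classical in
/-- The winding number of the zigzag path that traverses `e` from black to white. -/
noncomputable def winding [Fintype E] (e : E) : ℤ × ℤ :=
  ∑ x ∈ Finset.univ.filter (fun x => D.zigzagStep.SameCycle e x), (D.disp (D.rotW x) - D.disp x)

/-- The direction of the winding number of the zigzag path that comes just after `e` in
counterclockwise order around either end of `e`; it traverses `e` from black to white. -/
noncomputable def dirAfter [Fintype E] (e : E) : Real.Angle := direction (toPlane (D.winding e))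

/-- The direction of the winding number of the zigzag path that comes just before `e` in
counterclockwise order around either end of `e`; it traverses `e` from white to black. -/
noncomputable def dirBefore [Fintype E] (e : E) : Real.Angle := D.dirAfter (D.rotW⁻¹ e)

/-- All nodes of one colour, with rotation `rot`, are properly ordered.  The zigzag paths around
the node of `e` are those that come just after the edges `f` of that node.  The conditions say
that their windings are nonzero with pairwise different directions (so that the directions have a
circular order), that the counterclockwise successor of a path around the node has as its
direction the counterclockwise successor among the directions of the paths at the node, and that
the two paths that cross at `e` have different directions (so a node cannot have valence one). -/
def NodesProperlyOrdered [Fintype E] (rot : Equiv.Perm E) : Prop :=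
  (∀ e, D.winding e ≠ 0) ∧
  (∀ e f, rot.SameCycle e f → D.dirAfter e = D.dirAfter f → e = f) ∧
  (∀ e f, rot.SameCycle e f → ¬ sbtw (D.dirAfter e) (D.dirAfter f) (D.dirAfter (rot e))) ∧
  (∀ e, D.dirBefore e ≠ D.dirAfter e)

/-- All nodes are properly ordered. -/
def ProperlyOrdered [Fintype E] : Prop :=
  D.NodesProperlyOrdered D.rotW ∧ D.NodesProperlyOrdered D.rotB

/-- Every node is an endpoint of exactly one edge of `M`. -/
def IsPerfectMatching (M : Set E) : Prop :=
  (∀ w : D.White, ∃! e, e ∈ M ∧ D.white e = w) ∧ (∀ b : D.Black, ∃! e, e ∈ M ∧ D.black e = b)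

/-- The ray in direction `r` does not have the direction of the winding of any zigzag path. -/
def IsRay [Fintype E] (r : ℝ × ℝ) : Prop :=
  r ≠ 0 ∧ ∀ e, direction r ≠ D.dirAfter e

/-- The edge that the ray in direction `r` chooses at one of its ends, where the rotation is
`rot`: the path just after `e` has the smallest counterclockwise angle with the ray, and the
path just before `e` the smallest clockwise angle, among the paths through that node. -/
def IsChosen [Fintype E] (rot : Equiv.Perm E) (r : ℝ × ℝ) (e : E) : Prop :=
  ∀ f, rot.SameCycle e f →
    ¬ sbtw (direction r) (D.dirAfter f) (D.dirAfter e) ∧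
    ¬ sbtw (D.dirBefore e) (D.dirAfter f) (direction r)

/-- The matching of the ray in direction `r`: the edges chosen at the nodes `v`, for all `v`. -/
def rayMatching [Fintype E] (r : ℝ × ℝ) : Set E :=
  {e | D.IsChosen D.rotW r e ∨ D.IsChosen D.rotB r e}

/-- The number of times that a closed curve with winding number `u` crosses the edge `e` with the
white endpoint on its left, minus the number of times that it crosses with the white endpoint on
its right (for the curve in its homology class that runs along the lattice of the chosen lifts;
another curve in the class gives the numbers for other choices of the lifts of the nodes). -/
def crossing (u : ℤ × ℤ) (e : E) : ℤ := wedge (D.disp e) u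

/-- The exponent `(a, b)` of the weight `c w ^ a z ^ b` of an edge, for curves `γ_w` and `γ_z` with
winding numbers `u` and `v`. -/
def exponent (u v : ℤ × ℤ) (e : E) : ℤ × ℤ := (D.crossing u e, D.crossing v e)

open Classical in
/-- The Kasteleyn matrix, with entries in the Laurent polynomials in `w` and `z`: the weighted
adjacency matrix with weight `c e * w ^ a * z ^ b` for the edge `e`. -/
noncomputable def kasteleyn [Fintype E] (u v : ℤ × ℤ) (c : E → ℂ) :
    Matrix D.White D.Black (AddMonoidAlgebra ℂ (ℤ × ℤ)) :=
  Matrix.of fun x y =>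
    ∑ e ∈ Finset.univ.filter (fun e => D.white e = x ∧ D.black e = y),
      AddMonoidAlgebra.single (D.exponent u v e) (c e)

open Classical in
/-- The determinant of the Kasteleyn matrix, the columns being listed by `β` (which matters only
for the sign). -/
noncomputable def kasteleynDet [Fintype E] (u v : ℤ × ℤ) (c : E → ℂ) (β : D.White ≃ D.Black) :
    AddMonoidAlgebra ℂ (ℤ × ℤ) :=
  ((D.kasteleyn u v c).submatrix id β).det

end Dimer

/-- The Newton polygon of a Laurent polynomial in two variables. -/
def newtonPolygon (f : AddMonoidAlgebra ℂ (ℤ × ℤ)) : Set (ℝ × ℝ) :=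
  convexHull ℝ (toPlane '' {p | f.coeff p ≠ 0})

namespace Dimer

variable {E : Type*} (D : Dimer E)

/-- The toric diagram. -/
noncomputable def toricDiagram [Fintype E] (u v : ℤ × ℤ) (c : E → ℂ) (β : D.White ≃ D.Black) :
    Set (ℝ × ℝ) :=
  newtonPolygon (D.kasteleynDet u v c β)

open Classical in
/-- The position of a perfect matching in the toric diagram: the exponent of the product of the
weights of its edges. -/
noncomputable def position [Fintype E] (u v : ℤ × ℤ) (M : Set E) : ℝ × ℝ :=
  toPlane (∑ e ∈ Finset.univ.filter (fun e => e ∈ M), D.exponent u v e)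

end Dimer

/-! Perfect matchings are relaxed to fractional ones: nonnegative edge weights with sum one at every
node. Positions are replaced by total displacements; `crossingMap` is the linear isomorphism between
the two, and it multiplies areas by `wedge u v`.

The topology enters through one formula, `Dimer.wedge_sum_zigzag`. The difference of two fractional
matchings is a cycle, and the wedge of its displacement with a combination of zigzag windings is the
weighted number of crossings, that is, the weights of the two edges at each turn at a white node. It
is proved by cohomology: the strands crossing the edges form a closed cochain, and a dimension count
shows that the closed cochains are spanned by coboundaries and the two coordinates. The two edges at
a turn have total weight at most one. Hence a matching that attains one at all turns of the paths in
some direction (`Tight`) is extremal for that direction (`wedge_vec_nonneg`).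

With angles measured from a ray, proper ordering means that the angles around a node have exactly
one descent, and the ray chooses the edge there. The two strands that cross on an edge are the same
at both ends, so the choices at the ends agree and form a perfect matching. Turning the ray past a
winding direction flips the matching along the paths of that direction and adds their windings to
the displacement. A ray matching is tight at the winding directions next to the ray on either side.
Unless all directions are collinear, the ray is a positive combination of these two, so its matching
minimises the wedge with the ray. For uniqueness, a fractional matching with the same displacement
admits the same successive flips: at each stage the bound in the previous direction forces weight
one on the edges to be removed (`eq_one_of_tight`). Collinear directions are treated separately. The
result is `IsPerfectMatching.support`.

Consequently only one term of the Kasteleyn determinant has the exponent of a ray matching, and that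
exponent is an extreme point. Separation by a functional, perturbed to a ray, puts all other
positions in the hull. Finally, differences of positions are sums of windings over sectors, and all
windings, weighted as in `meanWinding`, add up to zero; this gives the criterion for distinct
corners and their cyclic order. -/

theorem perm_inv_apply_self {α : Type*} (f : Equiv.Perm α) (x : α) : f⁻¹ (f x) = x :=
  f.symm_apply_apply x

theorem perm_apply_inv_self {α : Type*} (f : Equiv.Perm α) (x : α) : f (f⁻¹ x) = x :=
  f.apply_symm_apply x

/-! ### Cohomology of a cellular graph on the torus -/

namespace RibbonGraph

section Cochains

variable {E : Type*} (G : RibbonGraph E)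

theorem white_rotW (e : E) : G.white (G.rotW e) = G.white e :=
  Quotient.sound (Equiv.Perm.sameCycle_apply_left.2 (Equiv.Perm.SameCycle.refl _ _))

theorem black_rotB (e : E) : G.black (G.rotB e) = G.black e :=
  Quotient.sound (Equiv.Perm.sameCycle_apply_left.2 (Equiv.Perm.SameCycle.refl _ _))

theorem white_rotW_inv (e : E) : G.white (G.rotW⁻¹ e) = G.white e :=
  Quotient.sound (Equiv.Perm.sameCycle_symm_apply_left.2 (Equiv.Perm.SameCycle.refl _ _))

theorem black_rotB_inv (e : E) : G.black (G.rotB⁻¹ e) = G.black e :=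
  Quotient.sound (Equiv.Perm.sameCycle_symm_apply_left.2 (Equiv.Perm.SameCycle.refl _ _))

/-- The face to the left of an edge. -/
def face (e : E) : G.Face := Quotient.mk _ e

theorem face_faceStep (e : E) : G.face (G.faceStep e) = G.face e :=
  Quotient.sound (Equiv.Perm.sameCycle_apply_left.2 (Equiv.Perm.SameCycle.refl _ _))

theorem faceStep_apply (e : E) : G.faceStep e = G.rotW⁻¹ (G.rotB⁻¹ e) := rfl

/-- `r` is a potential of the cochain `φ` on the faces: `r e` is the value at the centre of the face
to the left of `e`, relative to the white endpoint of `e`. -/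
def IsPotential (φ r : E → ℝ) : Prop :=
  ∀ e, r (G.faceStep e) = r e - (φ e - φ (G.rotB⁻¹ e))

/-- The cup product of a cochain and a closed cochain with potential `s`. -/
def cup [Fintype E] (φ s : E → ℝ) : ℝ := ∑ e, φ e * (s e - s (G.rotW⁻¹ e))

variable {G}

/-- The face to the right of `e` is to the left of both `rotW⁻¹ e` and `rotB e`; this compares its
potential as seen from the two ends of `e`. -/
theorem IsPotential.rotW_inv {φ r : E → ℝ} (h : G.IsPotential φ r) (e : E) :
    r (G.rotW⁻¹ e) = r (G.rotB e) - φ (G.rotB e) + φ e := by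
  have := h (G.rotB e)
  rw [faceStep_apply, perm_inv_apply_self] at this
  rw [this]; ring

/-- Antisymmetry of the cup product on closed cochains. Each summand splits into a difference along
`rotW`, with values taken relative to the white end, and one along `rotB`, relative to the black
end; both sum to zero. -/
theorem cup_add_cup [Fintype E] {φ ψ r s : E → ℝ} (hr : G.IsPotential φ r)
    (hs : G.IsPotential ψ s) : G.cup φ s + G.cup ψ r = 0 := by
  have key : ∀ e, φ e * (s e - s (G.rotW⁻¹ e)) + ψ e * (r e - r (G.rotW⁻¹ e)) =
      (r e * s e - (r (G.rotW⁻¹ e)) * s (G.rotW⁻¹ e)) -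
      ((r e - φ e) * (s e - ψ e) -
        (r (G.rotB e) - φ (G.rotB e)) * (s (G.rotB e) - ψ (G.rotB e))) := by
    intro e
    rw [hr.rotW_inv, hs.rotW_inv]; ring
  unfold cup
  rw [← Finset.sum_add_distrib, Finset.sum_congr rfl fun e _ => key e, Finset.sum_sub_distrib,
    Finset.sum_sub_distrib, Finset.sum_sub_distrib,
    Equiv.sum_comp G.rotW⁻¹ (fun e => r e * s e),
    Equiv.sum_comp G.rotB (fun e => (r e - φ e) * (s e - ψ e))]
  ring

/-- Summation by parts: the jumps of `s` across the edges of a white node cancel, and so do those at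
a black node once `s` is taken relative to it. -/
theorem cup_coboundary [Fintype E] {ψ s : E → ℝ} (hs : G.IsPotential ψ s)
    (g : G.White → ℝ) (g' : G.Black → ℝ) :
    G.cup (fun e => g' (G.black e) - g (G.white e)) s = 0 := by
  have key : ∀ e, (g' (G.black e) - g (G.white e)) * (s e - s (G.rotW⁻¹ e)) =
      (g' (G.black e) * (s e - ψ e) -
        g' (G.black (G.rotB e)) * (s (G.rotB e) - ψ (G.rotB e))) -
      (g (G.white e) * s e - g (G.white (G.rotW⁻¹ e)) * s (G.rotW⁻¹ e)) := by
    intro e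
    rw [white_rotW_inv, black_rotB]
    have := hs.rotW_inv e
    linear_combination (-g' (G.black e)) * this
  unfold cup
  rw [Finset.sum_congr rfl fun e _ => key e, Finset.sum_sub_distrib, Finset.sum_sub_distrib,
    Finset.sum_sub_distrib, Equiv.sum_comp G.rotW⁻¹ (fun e => g (G.white e) * s e),
    Equiv.sum_comp G.rotB (fun e => g' (G.black e) * (s e - ψ e))]
  ring

theorem isPotential_coboundary (g : G.White → ℝ) (g' : G.Black → ℝ) :
    G.IsPotential (fun e => g' (G.black e) - g (G.white e)) (fun e => -g (G.white e)) := by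
  intro e
  simp only [faceStep_apply, white_rotW_inv, black_rotB_inv]
  ring

theorem IsPotential.linear {φ ψ r s : E → ℝ} (hr : G.IsPotential φ r)
    (hs : G.IsPotential ψ s) (a b : ℝ) :
    G.IsPotential (fun e => a * φ e + b * ψ e) (fun e => a * r e + b * s e) := by
  intro e
  simp only [hr e, hs e]
  ring

theorem cup_linear [Fintype E] (φ ψ s : E → ℝ) (a b : ℝ) :
    G.cup (fun e => a * φ e + b * ψ e) s = a * G.cup φ s + b * G.cup ψ s := by
  simp only [cup, Finset.mul_sum, ← Finset.sum_add_distrib]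
  exact Finset.sum_congr rfl fun e _ => by ring

theorem cup_add [Fintype E] (φ ψ s : E → ℝ) :
    G.cup (fun e => φ e + ψ e) s = G.cup φ s + G.cup ψ s := by
  simp only [cup, ← Finset.sum_add_distrib]
  exact Finset.sum_congr rfl fun e _ => by ring

/-- The displacements along the first axis. -/
noncomputable def dispFst (G : RibbonGraph E) (e : E) : ℝ := ((G.disp e).1 : ℝ)

/-- The displacements along the second axis. -/
noncomputable def dispSnd (G : RibbonGraph E) (e : E) : ℝ := ((G.disp e).2 : ℝ)

variable [Fintype E]

theorem IsCellular.const_of_invariant (h : G.IsCellular) {X : Type*} (γ : E → X)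
    (hW : ∀ e, γ (G.rotW e) = γ e) (hB : ∀ e, γ (G.rotB e) = γ e) (e f : E) : γ e = γ f := by
  obtain ⟨g, hg, rfl⟩ := h.1 e f
  have : ∀ g ∈ Subgroup.closure {G.rotW, G.rotB}, ∀ e, γ (g e) = γ e := by
    intro g hg
    induction hg using Subgroup.closure_induction with
    | mem x hx =>
      rcases hx with rfl | rfl
      · exact hW
      · exact hB
    | one => intro e; rfl
    | mul x y _ _ hx hy => intro e; rw [Equiv.Perm.mul_apply, hx, hy]
    | inv x _ hx => intro e; rw [← hx (x⁻¹ e), perm_apply_inv_self]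
  exact (this g hg e).symm

theorem IsCellular.nonempty (h : G.IsCellular) : Nonempty E := by
  by_contra hE
  rw [not_nonempty_iff] at hE
  obtain ⟨-, -, r, -, hr⟩ := h
  simp at hr

/-- The degree condition says that two cup products differ by `2`; by antisymmetry they are
opposite, hence `1` and `-1`. -/
theorem IsCellular.exists_potentials (h : G.IsCellular) :
    ∃ r s : E → ℝ, G.IsPotential G.dispFst r ∧ G.IsPotential G.dispSnd s ∧
      G.cup G.dispFst s = 1 := by
  obtain ⟨-, -, r, hr, hsum⟩ := h
  have h1 : G.IsPotential G.dispFst (fun e => ((r e).1 : ℝ)) := by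
    intro e
    simp only [hr e, dispFst, Prod.fst_sub]
    push_cast
    ring
  have h2 : G.IsPotential G.dispSnd (fun e => ((r e).2 : ℝ)) := by
    intro e
    simp only [hr e, dispSnd, Prod.snd_sub]
    push_cast
    ring
  refine ⟨_, _, h1, h2, ?_⟩
  have h12 := cup_add_cup h1 h2
  have key : G.cup G.dispFst (fun e => ((r e).2 : ℝ)) -
      G.cup G.dispSnd (fun e => ((r e).1 : ℝ)) = 2 := by
    have hcast : ((∑ e, wedge (G.disp e) (r e - (r (G.rotB e) - G.disp (G.rotB e) + G.disp e)) :
      ℤ) : ℝ) = 2 := by rw [hsum]; norm_num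
    rw [← hcast]
    unfold cup
    rw [← Finset.sum_sub_distrib]
    push_cast
    refine Finset.sum_congr rfl fun e _ => ?_
    rw [h1.rotW_inv, h2.rotW_inv]
    simp only [wedge, dispFst, dispSnd, Prod.fst_sub, Prod.snd_sub, Prod.fst_add, Prod.snd_add]
    push_cast
    ring
  linarith

open Classical in
/-- The values of a cochain on the boundaries of the faces. -/
noncomputable def faceBoundary (G : RibbonGraph E) : (E → ℝ) →ₗ[ℝ] (G.Face → ℝ) where
  toFun φ f := ∑ e with G.face e = f, (φ e - φ (G.rotB⁻¹ e))
  map_add' φ ψ := by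
    ext f
    simp only [Pi.add_apply, ← Finset.sum_add_distrib]
    exact Finset.sum_congr rfl fun e _ => by ring
  map_smul' a φ := by
    ext f
    simp only [Pi.smul_apply, smul_eq_mul, RingHom.id_apply, Finset.mul_sum]
    exact Finset.sum_congr rfl fun e _ => by ring

theorem IsPotential.faceBoundary_eq_zero {φ r : E → ℝ} (h : G.IsPotential φ r) :
    G.faceBoundary φ = 0 := by
  classical
  ext f
  change ∑ e with G.face e = f, (φ e - φ (G.rotB⁻¹ e)) = 0
  have key : ∀ e, φ e - φ (G.rotB⁻¹ e) = r e - r (G.faceStep e) := fun e => by rw [h e]; ring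
  rw [Finset.sum_congr rfl fun e _ => key e, Finset.sum_sub_distrib, sub_eq_zero,
    Finset.sum_filter, Finset.sum_filter,
    ← Equiv.sum_comp G.faceStep (fun e => if G.face e = f then r e else 0)]
  simp only [face_faceStep]

/-- The transpose of the coboundary: an edge occurs in the boundaries of the faces on its two sides,
with opposite signs. -/
theorem sum_mul_faceBoundary [Fintype G.Face] (l : G.Face → ℝ) (φ : E → ℝ) :
    ∑ f, l f * G.faceBoundary φ f = ∑ e, φ e * (l (G.face e) - l (G.face (G.rotB e))) := by
  classical
  have h1 : ∀ f, l f * G.faceBoundary φ f =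
      ∑ e with G.face e = f, l (G.face e) * (φ e - φ (G.rotB⁻¹ e)) := by
    intro f
    change l f * ∑ e with G.face e = f, (φ e - φ (G.rotB⁻¹ e)) = _
    rw [Finset.mul_sum]
    refine Finset.sum_congr rfl fun e he => ?_
    rw [(Finset.mem_filter.1 he).2]
  rw [Finset.sum_congr rfl fun f _ => h1 f, Finset.sum_fiberwise]
  simp only [mul_sub, Finset.sum_sub_distrib]
  congr 1
  · exact Finset.sum_congr rfl fun e _ => mul_comm _ _
  · rw [← Equiv.sum_comp G.rotB]
    exact Finset.sum_congr rfl fun e _ => by rw [perm_inv_apply_self, mul_comm]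

/-- A functional vanishing on all boundary values has equal coefficients at the two faces beside
every edge. By connectedness it is a multiple of the total, so the cokernel has dimension at most
one. -/
theorem IsCellular.card_face_le (h : G.IsCellular) :
    Nat.card G.Face ≤ Module.finrank ℝ (LinearMap.range G.faceBoundary) + 1 := by
  classical
  let _ : Fintype G.Face := Fintype.ofFinite _
  rw [Nat.card_eq_fintype_card, ← Module.finrank_fintype_fun_eq_card ℝ,
    ← Subspace.finrank_add_finrank_dualAnnihilator_eq (LinearMap.range G.faceBoundary)]
  refine Nat.add_le_add_left ?_ _
  let tot : Module.Dual ℝ (G.Face → ℝ) := ∑ f, LinearMap.proj f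
  obtain ⟨e₀⟩ := h.nonempty
  have key : ∀ x ∈ (LinearMap.range G.faceBoundary).dualAnnihilator, ∃ c : ℝ, x = c • tot := by
    intro x hx
    rw [Submodule.mem_dualAnnihilator] at hx
    let l : G.Face → ℝ := fun f => x (Pi.single f 1)
    have hxl : ∀ y, x y = ∑ f, l f * y f := by
      intro y
      rw [LinearMap.pi_apply_eq_sum_univ x y]
      exact Finset.sum_congr rfl fun f _ => by
        rw [smul_eq_mul, mul_comm]
        congr 2
        ext j
        simp [Pi.single_apply, eq_comm]
    have hB : ∀ e, l (G.face e) = l (G.face (G.rotB e)) := by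
      intro e
      have := hx _ ⟨Pi.single e 1, rfl⟩
      rw [hxl, sum_mul_faceBoundary] at this
      simp only [Pi.single_apply, ite_mul, one_mul, zero_mul, Finset.sum_ite_eq',
        Finset.mem_univ, if_true] at this
      linarith
    have hW : ∀ e, l (G.face (G.rotW e)) = l (G.face e) := by
      intro e
      have h1 := hB (G.rotW e)
      have h2 := G.face_faceStep (G.rotB (G.rotW e))
      rw [faceStep_apply, perm_inv_apply_self, perm_inv_apply_self] at h2
      rw [h1, h2]
    have hc := h.const_of_invariant (fun e => l (G.face e)) hW fun e => (hB e).symm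
    refine ⟨l (G.face e₀), LinearMap.ext fun y => ?_⟩
    rw [hxl, LinearMap.smul_apply]
    simp only [tot, LinearMap.sum_apply, LinearMap.proj_apply, smul_eq_mul, Finset.mul_sum]
    refine Finset.sum_congr rfl fun f _ => ?_
    obtain ⟨e, rfl⟩ := Quotient.exists_rep f
    congr 1
    exact hc e e₀
  calc _ ≤ Module.finrank ℝ (ℝ ∙ tot) := Submodule.finrank_mono fun x hx => by
        obtain ⟨c, rfl⟩ := key x hx
        exact Submodule.smul_mem _ _ (Submodule.mem_span_singleton_self _)
    _ ≤ 1 := (finrank_span_le_card _).trans (by simp)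

/-- The cochains that are combinations of the displacements and of a coboundary. -/
noncomputable def cochainMap (G : RibbonGraph E) :
    ((G.White → ℝ) × (G.Black → ℝ)) × (ℝ × ℝ) →ₗ[ℝ] (E → ℝ) where
  toFun x e := (x.1.2 (G.black e) - x.1.1 (G.white e)) +
    (x.2.1 * G.dispFst e + x.2.2 * G.dispSnd e)
  map_add' x y := by
    ext e
    simp only [Pi.add_apply, Prod.fst_add, Prod.snd_add]
    ring
  map_smul' a x := by
    ext e
    simp only [Pi.smul_apply, Prod.smul_fst, Prod.smul_snd, smul_eq_mul, RingHom.id_apply]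
    ring

/-- Cup products with the coordinates read off the cohomology class: coboundaries and the square of
each coordinate contribute nothing. -/
theorem cup_cochainMap {r s : E → ℝ}
    (hr : G.IsPotential G.dispFst r) (hs : G.IsPotential G.dispSnd s)
    (h1 : G.cup G.dispFst s = 1) (x : ((G.White → ℝ) × (G.Black → ℝ)) × (ℝ × ℝ)) :
    G.cup (G.cochainMap x) s = x.2.1 ∧ G.cup (G.cochainMap x) r = -x.2.2 := by
  have e1 : ∀ t, G.cup (G.cochainMap x) t = _ := fun t =>
    cup_add (G := G) (fun e => x.1.2 (G.black e) - x.1.1 (G.white e))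
      (fun e => x.2.1 * G.dispFst e + x.2.2 * G.dispSnd e) t
  have h11 := cup_add_cup hr hr
  have h22 := cup_add_cup hs hs
  have h12 := cup_add_cup hr hs
  rw [e1, e1, cup_coboundary hs, cup_coboundary hr, cup_linear, cup_linear]
  constructor
  · rw [h1]; linear_combination x.2.2 * h22 / 2
  · linear_combination x.2.1 * h11 / 2 + x.2.2 * h12 - x.2.2 * h1

theorem IsCellular.exists_eq_cochainMap (h : G.IsCellular) {φ r : E → ℝ}
    (hφ : G.IsPotential φ r) : ∃ x, G.cochainMap x = φ := by
  classical
  let _ : Fintype G.Face := Fintype.ofFinite _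
  let _ : Fintype G.White := Fintype.ofFinite _
  let _ : Fintype G.Black := Fintype.ofFinite _
  obtain ⟨r₁, r₂, hr₁, hr₂, h1⟩ := h.exists_potentials
  obtain ⟨e₀⟩ := h.nonempty
  have hle : LinearMap.range G.cochainMap ≤ LinearMap.ker G.faceBoundary := by
    rintro _ ⟨x, rfl⟩
    have p1 := isPotential_coboundary (G := G) x.1.1 x.1.2
    have p2 := hr₁.linear hr₂ x.2.1 x.2.2
    have p3 := p1.linear p2 1 1
    simp only [one_mul] at p3
    exact p3.faceBoundary_eq_zero
  have hker : Module.finrank ℝ (LinearMap.ker G.cochainMap) ≤ 1 := by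
    refine (Submodule.finrank_mono (t := ℝ ∙ ((((fun _ => 1 : G.White → ℝ),
      (fun _ => 1 : G.Black → ℝ)), ((0 : ℝ), (0 : ℝ))) :
        ((G.White → ℝ) × (G.Black → ℝ)) × (ℝ × ℝ))) fun x hx => ?_).trans
      ((finrank_span_le_card _).trans (by simp))
    rw [LinearMap.mem_ker] at hx
    have hz : ∀ t, G.cup (0 : E → ℝ) t = 0 := fun t => by simp [cup]
    have hc := cup_cochainMap hr₁ hr₂ h1 x
    rw [hx, hz, hz] at hc
    obtain ⟨ha, hb⟩ := hc
    have hb' : x.2.2 = 0 := by linarith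
    have hg : ∀ e, x.1.2 (G.black e) = x.1.1 (G.white e) := by
      intro e
      have := congrFun hx e
      simp only [cochainMap, LinearMap.coe_mk, AddHom.coe_mk, ← ha, hb', Pi.zero_apply] at this
      linarith
    have hconst := h.const_of_invariant (fun e => x.1.1 (G.white e))
      (fun e => by rw [white_rotW]) (fun e => by rw [← hg, ← hg, black_rotB])
    rw [Submodule.mem_span_singleton]
    refine ⟨x.1.1 (G.white e₀), ?_⟩
    ext f
    · obtain ⟨e, rfl⟩ := Quotient.exists_rep f
      exact (mul_one _).trans (hconst e₀ e)
    · obtain ⟨e, rfl⟩ := Quotient.exists_rep f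
      have := (hconst e₀ e).trans (hg e).symm
      exact (mul_one _).trans this
    · simpa using ha
    · simpa using hb'.symm
  have hf := h.card_face_le
  have h2 := LinearMap.finrank_range_add_finrank_ker G.faceBoundary
  have h3 := LinearMap.finrank_range_add_finrank_ker G.cochainMap
  have h4 := h.2.1
  simp only [Module.finrank_prod, Module.finrank_fintype_fun_eq_card, Module.finrank_self] at h2 h3
  simp only [Nat.card_eq_fintype_card] at h4 hf
  -- The range has dimension at least `W + B + 2 - 1`, the closed cochains at most `E - F + 1`;
  -- Euler characteristic zero makes these equal.
  have heq := Submodule.eq_of_le_of_finrank_le hle (by omega)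
  have : φ ∈ LinearMap.ker G.faceBoundary := hφ.faceBoundary_eq_zero
  rw [← heq] at this
  exact this

end Cochains

end RibbonGraph

/-! ### Intersection numbers with zigzag paths -/

/-- A function on a subset, transported along a permutation whose first return map to the subset is
`ρ`, until the subset is met again. -/
theorem exists_transport {E F : Type*} (σ : Equiv.Perm F) (ρ : Equiv.Perm E) (ι : E ↪ F)
    (hι : ∀ e, ∃ n : ℕ, 0 < n ∧ (σ ^ n) (ι e) = ι (ρ e) ∧
      ∀ m : ℕ, 0 < m → m < n → (σ ^ m) (ι e) ∉ Set.range ι) (χ : E → ℝ) :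
    ∃ α : F → ℝ, (∀ e, α (ι e) = χ e) ∧ (∀ f ∉ Set.range ι, α (σ⁻¹ f) = α f) ∧
      ∀ e, α (σ⁻¹ (ι e)) = χ (ρ⁻¹ e) := by
  classical
  let P : F → ℕ → Prop := fun f k => (σ⁻¹ ^ k) f ∈ Set.range ι
  -- The value at the first edge of the subset met when going backwards from `f`; cycles that miss
  -- the subset get the harmless constant `0`.
  let α : F → ℝ := fun f =>
    if h : ∃ k, P f k then Function.extend ι χ 0 ((σ⁻¹ ^ Nat.find h) f) else 0
  have h1 : ∀ e, α (ι e) = χ e := by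
    intro e
    have h : ∃ k, P (ι e) k := ⟨0, e, rfl⟩
    have h0 : Nat.find h = 0 := (Nat.find_eq_zero h).2 ⟨e, rfl⟩
    simp only [α, dif_pos h, h0, pow_zero, Equiv.Perm.one_apply]
    exact ι.injective.extend_apply _ _ _
  have h2 : ∀ f ∉ Set.range ι, α (σ⁻¹ f) = α f := by
    intro f hf
    have hs : ∀ k, P f (k + 1) ↔ P (σ⁻¹ f) k := fun k => by
      simp only [P, pow_succ, Equiv.Perm.mul_apply]
    by_cases h : ∃ k, P f k
    · have h' : ∃ k, P f (k + 1) := by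
        obtain ⟨k, hk⟩ := h
        cases k with
        | zero => exact absurd hk hf
        | succ k => exact ⟨k, hk⟩
      have h'' : ∃ k, P (σ⁻¹ f) k := by simpa only [hs] using h'
      have hfind := Nat.find_comp_succ h h' hf
      have hfind' : Nat.find h' = Nat.find h'' := Nat.find_congr' fun {k} => hs k
      simp only [α, dif_pos h, dif_pos h'']
      rw [hfind, hfind', pow_succ, Equiv.Perm.mul_apply]
    · have h'' : ¬ ∃ k, P (σ⁻¹ f) k := fun ⟨k, hk⟩ => h ⟨k + 1, (hs k).2 hk⟩
      simp only [α, dif_neg h, dif_neg h'']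
  refine ⟨α, h1, h2, fun e => ?_⟩
  obtain ⟨n, hn, hn1, hn2⟩ := hι (ρ⁻¹ e)
  rw [perm_apply_inv_self] at hn1
  have key : ∀ m < n, α ((σ ^ m) (ι (ρ⁻¹ e))) = χ (ρ⁻¹ e) := by
    intro m
    induction m with
    | zero => intro _; exact h1 _
    | succ m ih =>
      intro hm
      rw [← h2 _ (hn2 (m + 1) m.succ_pos hm), pow_succ', Equiv.Perm.mul_apply,
        perm_inv_apply_self]
      exact ih (by omega)
  obtain ⟨k, rfl⟩ : ∃ k, n = k + 1 := ⟨n - 1, by omega⟩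
  rw [← hn1, pow_succ', Equiv.Perm.mul_apply, perm_inv_apply_self]
  exact key k k.lt_succ_self

theorem sum_embedding_of_eq_zero {E F : Type*} [Fintype E] [Fintype F] (ι : E ↪ F) (φ : F → ℝ)
    (h : ∀ f ∉ Set.range ι, φ f = 0) : ∑ f, φ f = ∑ e, φ (ι e) := by
  classical
  rw [← Finset.sum_map Finset.univ ι φ]
  refine (Finset.sum_subset (Finset.subset_univ _) fun f _ hf => h f ?_).symm
  simpa using hf

namespace Dimer

variable {E : Type*} [Fintype E] (D : Dimer E)

/-- The displacement of an edge as a vector of the plane. -/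
noncomputable def planeDisp (e : E) : ℝ × ℝ := toPlane (D.disp e)

theorem zigzagStep_rotW_inv (e : E) : D.zigzagStep (D.rotW⁻¹ e) = D.rotB⁻¹ e := by
  rw [zigzagStep, Equiv.Perm.mul_apply, perm_apply_inv_self]

theorem rotB_zigzagStep (e : E) : D.rotB (D.zigzagStep e) = D.rotW e := by
  rw [zigzagStep, Equiv.Perm.mul_apply, perm_apply_inv_self]

/-- The intersection number of a cycle with (a combination of) zigzag paths. -/
theorem wedge_sum_zigzag (c χ : E → ℝ)
    (hW : ∀ g : E → ℝ, (∀ e, g (D.rotW e) = g e) → ∑ e, c e * g e = 0)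
    (hB : ∀ g : E → ℝ, (∀ e, g (D.rotB e) = g e) → ∑ e, c e * g e = 0)
    (hχ : ∀ e, χ (D.zigzagStep e) = χ e) :
    wedge (∑ e, c e • D.planeDisp e)
      (∑ x, χ x • (D.planeDisp (D.rotW x) - D.planeDisp x)) =
    ∑ e, c e * (χ e + χ (D.rotW⁻¹ e)) := by
  obtain ⟨N, H, ι, hH, hdisp, hιW, hιB⟩ := D.toroidal
  have hχ' : ∀ e, χ (D.rotB⁻¹ e) = χ (D.rotW⁻¹ e) := fun e => by
    rw [← zigzagStep_rotW_inv, hχ]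
  obtain ⟨α, hα1, hα2, hα3⟩ := exists_transport H.rotW D.rotW ι hιW χ
  obtain ⟨β, hβ1, hβ2, hβ3⟩ := exists_transport H.rotB D.rotB ι hιB χ
  -- The cochain counts the strands crossing an edge. On the subgraph the strands are the same at
  -- both ends, as `χ` is constant along zigzag paths; on an added edge, `α` and `β` do not change
  -- across it.
  have hsymm : ∀ f, α f + β (H.rotB⁻¹ f) = β f + α (H.rotW⁻¹ f) := by
    intro f
    by_cases hf : f ∈ Set.range ι
    · obtain ⟨e, rfl⟩ := hf
      rw [hα1, hα3, hβ1, hβ3, hχ']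
    · rw [hα2 f hf, hβ2 f hf, add_comm]
  have hpot : H.IsPotential (fun f => α f + β (H.rotB⁻¹ f)) α := by
    intro f
    simp only [hsymm (H.rotB⁻¹ f), RibbonGraph.faceStep_apply]
    ring
  obtain ⟨r, s, hr, hs, hrs⟩ := hH.exists_potentials
  obtain ⟨x, hx⟩ := hH.exists_eq_cochainMap hpot
  obtain ⟨ha, hb⟩ := RibbonGraph.cup_cochainMap hr hs hrs x
  rw [hx] at ha hb
  have hcup : ∀ φ : Fin N → ℝ, H.cup φ α = ∑ y, χ y * (φ (ι y) - φ (ι (D.rotW y))) := by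
    intro φ
    unfold RibbonGraph.cup
    rw [sum_embedding_of_eq_zero ι _ fun f hf => by rw [hα2 f hf]; ring]
    simp only [hα1, hα3, mul_sub, Finset.sum_sub_distrib]
    congr 1
    · exact Finset.sum_congr rfl fun e _ => mul_comm _ _
    · rw [← Equiv.sum_comp D.rotW]
      exact Finset.sum_congr rfl fun e _ => by rw [perm_inv_apply_self, mul_comm]
  -- The coordinates of the class of the strand cochain are cup products with the displacements,
  -- which `hcup` turns into the components of the zigzag windings. Pairing with the cycle `c` then
  -- kills the coboundary part.
  have h1 := RibbonGraph.cup_add_cup hpot hs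
  have h2 := RibbonGraph.cup_add_cup hpot hr
  rw [ha, hcup] at h1
  rw [hb, hcup] at h2
  have hκ : ∀ e, χ e + χ (D.rotW⁻¹ e) = (x.1.2 (H.black (ι e)) - x.1.1 (H.white (ι e))) +
      (x.2.1 * H.dispFst (ι e) + x.2.2 * H.dispSnd (ι e)) := by
    intro e
    have := congrFun hx (ι e)
    simp only [hα1, hβ3, hχ'] at this
    exact this.symm
  have horbit : ∀ (σ : Equiv.Perm (Fin N)) (n : ℕ) (f : Fin N),
      σ.SameCycle ((σ ^ n) f) f := fun σ n f =>
    Equiv.Perm.sameCycle_pow_left.2 (Equiv.Perm.SameCycle.refl _ _)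
  have hg1 := hW (fun e => x.1.1 (H.white (ι e))) fun e => by
    obtain ⟨n, -, hn, -⟩ := hιW e
    rw [← hn]
    exact congrArg _ (Quotient.sound (horbit _ _ _))
  have hg2 := hB (fun e => x.1.2 (H.black (ι e))) fun e => by
    obtain ⟨n, -, hn, -⟩ := hιB e
    rw [← hn]
    exact congrArg _ (Quotient.sound (horbit _ _ _))
  have hR : ∑ e, c e * (χ e + χ (D.rotW⁻¹ e)) = x.2.1 * (∑ e, c e * H.dispFst (ι e)) +
      x.2.2 * (∑ e, c e * H.dispSnd (ι e)) := by
    have : ∀ e, c e * (χ e + χ (D.rotW⁻¹ e)) =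
        (c e * x.1.2 (H.black (ι e)) - c e * x.1.1 (H.white (ι e))) +
        (x.2.1 * (c e * H.dispFst (ι e)) + x.2.2 * (c e * H.dispSnd (ι e))) := fun e => by
      rw [hκ]; ring
    rw [Finset.sum_congr rfl fun e _ => this e, Finset.sum_add_distrib, Finset.sum_sub_distrib,
      hg1, hg2, Finset.sum_add_distrib, ← Finset.mul_sum, ← Finset.mul_sum]
    ring
  rw [hR]
  have hd1 : ∀ e, H.dispFst (ι e) = (D.planeDisp e).1 := fun e => by
    simp [RibbonGraph.dispFst, planeDisp, toPlane, hdisp]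
  have hd2 : ∀ e, H.dispSnd (ι e) = (D.planeDisp e).2 := fun e => by
    simp [RibbonGraph.dispSnd, planeDisp, toPlane, hdisp]
  simp only [hd1, hd2, mul_sub, Finset.sum_sub_distrib] at h1 h2 ⊢
  simp only [wedge, Prod.fst_sum, Prod.snd_sum, Prod.smul_fst, Prod.smul_snd, smul_eq_mul,
    Prod.fst_sub, Prod.snd_sub, mul_sub, Finset.sum_sub_distrib]
  linear_combination (-∑ e, c e * (D.planeDisp e).1) * h1 + (∑ e, c e * (D.planeDisp e).2) * h2

end Dimer

/-! ### Fractional matchings and zigzag flips -/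

open Classical in
/-- Averaging over the cycles of a permutation does not change the sum against an invariant
function. -/
theorem sum_smul_average {E V : Type*} [Fintype E] [AddCommGroup V] [Module ℝ V]
    (σ : Equiv.Perm E) (χ : E → ℝ) (hχ : ∀ e, χ (σ e) = χ e) (v : E → V) :
    ∑ x, χ x • v x = ∑ x, χ x •
      ((Finset.univ.filter (σ.SameCycle x)).card : ℝ)⁻¹ • ∑ y with σ.SameCycle x y, v y := by
  have hinv : ∀ x y, σ.SameCycle x y → χ x = χ y := by
    rintro x y ⟨n, rfl⟩
    induction n using Int.induction_on with
    | zero => rfl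
    | succ n ih => rw [add_comm, zpow_add, zpow_one, Equiv.Perm.mul_apply, hχ, ← ih]
    | pred n ih =>
      rw [sub_eq_neg_add, zpow_add, zpow_neg_one, Equiv.Perm.mul_apply,
        ← hχ (σ⁻¹ _), perm_apply_inv_self, ← ih]
  have hcard : ∀ x y, σ.SameCycle x y → Finset.univ.filter (σ.SameCycle x) =
      Finset.univ.filter (σ.SameCycle y) := fun x y h => by
    ext z
    simp only [Finset.mem_filter, Finset.mem_univ, true_and]
    exact ⟨fun hz => h.symm.trans hz, fun hz => h.trans hz⟩
  simp only [Finset.smul_sum, Finset.sum_filter]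
  -- After the exchange the inner sum runs over the cycle of `y` with a constant summand, so the
  -- size of the cycle cancels the normalisation.
  rw [Finset.sum_comm]
  refine Finset.sum_congr rfl fun y _ => ?_
  have h1 : ∀ x, (if σ.SameCycle x y then
      χ x • ((Finset.univ.filter (σ.SameCycle x)).card : ℝ)⁻¹ • v y else 0) =
      if σ.SameCycle y x then
        χ y • ((Finset.univ.filter (σ.SameCycle y)).card : ℝ)⁻¹ • v y else 0 := by
    intro x
    by_cases h : σ.SameCycle x y
    · rw [if_pos h, if_pos h.symm, hinv x y h, hcard x y h]
    · rw [if_neg h, if_neg fun h' => h h'.symm]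
  have h1' := Finset.sum_congr rfl fun x (_ : x ∈ Finset.univ) => h1 x
  simp only [smul_ite, smul_zero] at h1' ⊢
  have hne : ((Finset.univ.filter (σ.SameCycle y)).card : ℝ) ≠ 0 := by
    rw [Nat.cast_ne_zero, Finset.card_ne_zero]
    exact ⟨y, by simp [Equiv.Perm.SameCycle.refl]⟩
  rw [h1', ← Finset.sum_filter, Finset.sum_const, ← Nat.cast_smul_eq_nsmul ℝ,
    smul_comm (χ y) (_ : ℝ)⁻¹, smul_inv_smul₀ hne]

open Classical in
/-- The values of `m` at each node of the given colour add up to `1`. -/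
def NodeSumsOne {E : Type*} [Fintype E] (rot : Equiv.Perm E) (m : E → ℝ) : Prop :=
  ∀ e, ∑ f with rot.SameCycle e f, m f = 1

namespace NodeSumsOne

variable {E : Type*} [Fintype E] {rot : Equiv.Perm E} {m m' : E → ℝ}

theorem sum_sub_mul_eq_zero (h : NodeSumsOne rot m) (h' : NodeSumsOne rot m') (g : E → ℝ)
    (hg : ∀ e, g (rot e) = g e) : ∑ e, (m e - m' e) * g e = 0 := by
  classical
  have h1 := sum_smul_average rot g hg m
  have h2 := sum_smul_average rot g hg m'
  simp only [h _, smul_eq_mul] at h1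
  simp only [h' _, smul_eq_mul] at h2
  simp only [sub_mul, Finset.sum_sub_distrib]
  rw [sub_eq_zero]
  simp only [mul_comm (m _), mul_comm (m' _)]
  rw [h1, h2]

/-- Each edge hands `χ` on to the next edge of the same node. -/
theorem flip (h : NodeSumsOne rot m) (χ : E → ℝ) :
    NodeSumsOne rot (fun e => m e + χ (rot⁻¹ e) - χ e) := by
  classical
  intro e
  simp only [Finset.sum_sub_distrib, Finset.sum_add_distrib, h e]
  have : ∑ f with rot.SameCycle e f, χ (rot⁻¹ f) = ∑ f with rot.SameCycle e f, χ f := by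
    rw [Finset.sum_filter, Finset.sum_filter, ← Equiv.sum_comp rot⁻¹ (fun f =>
      if rot.SameCycle e f then χ f else 0)]
    refine Finset.sum_congr rfl fun f _ => ?_
    have : rot.SameCycle e (rot⁻¹ f) ↔ rot.SameCycle e f :=
      Equiv.Perm.sameCycle_symm_apply_right
    simp only [this]
  rw [this]
  ring

theorem add_le_one (h : NodeSumsOne rot m) (h0 : ∀ e, 0 ≤ m e) {e f : E} (hef : e ≠ f)
    (hc : rot.SameCycle e f) : m e + m f ≤ 1 := by
  classical
  rw [← h e, ← Finset.sum_pair hef]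
  refine Finset.sum_le_sum_of_subset_of_nonneg ?_ fun x _ _ => h0 x
  intro x hx
  simp only [Finset.mem_insert, Finset.mem_singleton] at hx
  rcases hx with rfl | rfl
  · simp [Equiv.Perm.SameCycle.refl]
  · simpa using hc

theorem eq_of_le (h : NodeSumsOne rot m) (h' : NodeSumsOne rot m') (hle : ∀ e, m e ≤ m' e) :
    m = m' := by
  classical
  funext e
  have := (Finset.sum_eq_sum_iff_of_le fun f (_ : f ∈ Finset.univ.filter (rot.SameCycle e)) =>
    hle f).1 ((h e).trans (h' e).symm)
  exact this e (by simp [Equiv.Perm.SameCycle.refl])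

end NodeSumsOne

namespace Dimer

variable {E : Type*} [Fintype E] (D : Dimer E)

open Classical in
/-- The winding of the zigzag path of `e` divided by half of its length. -/
noncomputable def meanWinding (e : E) : ℝ × ℝ :=
  ((Finset.univ.filter (D.zigzagStep.SameCycle e)).card : ℝ)⁻¹ • toPlane (D.winding e)

theorem toPlane_sum {ι : Type*} (s : Finset ι) (f : ι → ℤ × ℤ) :
    toPlane (∑ i ∈ s, f i) = ∑ i ∈ s, toPlane (f i) := by
  simp [toPlane, Prod.ext_iff, Prod.fst_sum, Prod.snd_sum]

theorem toPlane_sub (p q : ℤ × ℤ) : toPlane (p - q) = toPlane p - toPlane q := by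
  simp [toPlane]

theorem sum_smul_meanWinding (χ : E → ℝ) (hχ : ∀ e, χ (D.zigzagStep e) = χ e) :
    ∑ x, χ x • (D.planeDisp (D.rotW x) - D.planeDisp x) = ∑ x, χ x • D.meanWinding x := by
  classical
  rw [sum_smul_average D.zigzagStep χ hχ]
  refine Finset.sum_congr rfl fun x _ => ?_
  rw [meanWinding, winding, toPlane_sum]
  simp only [toPlane_sub, planeDisp]

/-- A fractional perfect matching. -/
structure IsFractional (m : E → ℝ) : Prop where
  nonneg : ∀ e, 0 ≤ m e
  white : NodeSumsOne D.rotW m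
  black : NodeSumsOne D.rotB m

/-- The total displacement of the edges with multiplicities `m`. -/
noncomputable def totalDisp (m : E → ℝ) : ℝ × ℝ := ∑ e, m e • D.planeDisp e

/-- Replace the edges before the turns at the white nodes of the zigzag paths, with multiplicity
`χ`, by the edges after these turns. -/
def zigzagFlip (m χ : E → ℝ) (e : E) : ℝ := m e + χ (D.rotW⁻¹ e) - χ e

theorem totalDisp_zigzagFlip (m χ : E → ℝ) (hχ : ∀ e, χ (D.zigzagStep e) = χ e) :
    D.totalDisp (D.zigzagFlip m χ) = D.totalDisp m + ∑ x, χ x • D.meanWinding x := by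
  rw [← D.sum_smul_meanWinding χ hχ]
  simp only [totalDisp, zigzagFlip, sub_smul, add_smul, smul_sub, Finset.sum_sub_distrib,
    Finset.sum_add_distrib]
  rw [← Equiv.sum_comp D.rotW (fun e => χ (D.rotW⁻¹ e) • D.planeDisp e)]
  simp only [perm_inv_apply_self]
  abel

theorem zigzagFlip_white {m : E → ℝ} (h : NodeSumsOne D.rotW m) (χ : E → ℝ) :
    NodeSumsOne D.rotW (D.zigzagFlip m χ) := h.flip χ

/-- Since `χ` is constant along zigzag paths, its values at `rotW⁻¹ e` and `rotB⁻¹ e` agree, so the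
flip is also a shift around the black nodes. -/
theorem zigzagFlip_black {m : E → ℝ} (h : NodeSumsOne D.rotB m) (χ : E → ℝ)
    (hχ : ∀ e, χ (D.zigzagStep e) = χ e) : NodeSumsOne D.rotB (D.zigzagFlip m χ) := by
  have : D.zigzagFlip m χ = fun e => m e + χ (D.rotB⁻¹ e) - χ e := by
    funext e
    rw [zigzagFlip, ← zigzagStep_rotW_inv, hχ]
  rw [this]
  exact h.flip χ

-- The difference of two fractional matchings is a cycle, so the intersection formula applies;
-- regrouping by turns at white nodes gives the pair of edges at each turn.
variable {D} in
theorem wedge_totalDisp_sub {m m' : E → ℝ} (hm : D.IsFractional m) (hm' : D.IsFractional m')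
    (χ : E → ℝ) (hχ : ∀ e, χ (D.zigzagStep e) = χ e) :
    wedge (D.totalDisp m - D.totalDisp m') (∑ x, χ x • D.meanWinding x) =
      ∑ x, χ x * (m x + m (D.rotW x)) - ∑ x, χ x * (m' x + m' (D.rotW x)) := by
  have h := D.wedge_sum_zigzag (fun e => m e - m' e) χ
    (hm.white.sum_sub_mul_eq_zero hm'.white) (hm.black.sum_sub_mul_eq_zero hm'.black) hχ
  rw [D.sum_smul_meanWinding χ hχ] at h
  have h1 : ∀ c : E → ℝ, ∑ x, χ x * (c x + c (D.rotW x)) =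
      ∑ e, c e * (χ e + χ (D.rotW⁻¹ e)) := by
    intro c
    simp only [mul_add, Finset.sum_add_distrib]
    rw [← Equiv.sum_comp D.rotW (fun e => c e * χ (D.rotW⁻¹ e))]
    simp only [perm_inv_apply_self, mul_comm]
  rw [h1, h1, ← Finset.sum_sub_distrib, totalDisp, totalDisp, ← Finset.sum_sub_distrib]
  simp only [← sub_smul, ← sub_mul]
  exact h

end Dimer

/-! ### Angles of windings and tightness -/

/-- The unit vector with a given angle. -/
noncomputable def unitVec (a : ℝ) : ℝ × ℝ := (Real.cos a, Real.sin a)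

theorem wedge_unitVec (a b : ℝ) : wedge (unitVec a) (unitVec b) = Real.sin (b - a) := by
  rw [Real.sin_sub, wedge, unitVec, unitVec]; ring

theorem wedge_add_right (a b c : ℝ × ℝ) : wedge a (b + c) = wedge a b + wedge a c := by
  simp only [wedge, Prod.fst_add, Prod.snd_add]; ring

theorem wedge_sub_right (a b c : ℝ × ℝ) : wedge a (b - c) = wedge a b - wedge a c := by
  simp only [wedge, Prod.fst_sub, Prod.snd_sub]; ring

theorem wedge_smul_right (a b : ℝ × ℝ) (k : ℝ) : wedge a (k • b) = k * wedge a b := by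
  simp only [wedge, Prod.smul_fst, Prod.smul_snd, smul_eq_mul]; ring

theorem wedge_smul_left (a b : ℝ × ℝ) (k : ℝ) : wedge (k • a) b = k * wedge a b := by
  simp only [wedge, Prod.smul_fst, Prod.smul_snd, smul_eq_mul]; ring

theorem wedge_comm_neg (a b : ℝ × ℝ) : wedge a b = -wedge b a := by
  simp only [wedge]; ring

theorem wedge_sum_right {ι : Type*} (a : ℝ × ℝ) (s : Finset ι) (f : ι → ℝ × ℝ) :
    wedge a (∑ i ∈ s, f i) = ∑ i ∈ s, wedge a (f i) := by
  simp only [wedge, Prod.fst_sum, Prod.snd_sum, Finset.mul_sum, Finset.sum_sub_distrib]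

theorem wedge_sum_left {ι : Type*} (a : ℝ × ℝ) (s : Finset ι) (f : ι → ℝ × ℝ) :
    wedge (∑ i ∈ s, f i) a = ∑ i ∈ s, wedge (f i) a := by
  simp only [wedge, Prod.fst_sum, Prod.snd_sum, Finset.sum_mul, Finset.sum_sub_distrib]

/-- Around each node, the angles `t` in `[0, 2π)` increase counterclockwise, up to one jump. -/
structure AngleOrdered {E : Type*} (rot : Equiv.Perm E) (t : E → ℝ) : Prop where
  inj : ∀ e f, rot.SameCycle e f → t e = t f → e = f
  ne : ∀ e, t (rot e) ≠ t e
  desc : ∀ e f, rot.SameCycle e f → t (rot e) < t e → t (rot e) ≤ t f ∧ t f ≤ t e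

-- The descent into an edge of smallest angle is the only one, because by `desc` every descent ends
-- at the minimum over the node.
open Classical in
theorem AngleOrdered.nodeSumsOne {E : Type*} [Fintype E] {rot : Equiv.Perm E} {t : E → ℝ}
    (h : AngleOrdered rot t) :
    NodeSumsOne rot (fun e => if t e < t (rot⁻¹ e) then 1 else 0) := by
  intro e
  obtain ⟨x, hx, hmin⟩ := Finset.exists_min_image (Finset.univ.filter (rot.SameCycle e)) t
    ⟨e, by simp [Equiv.Perm.SameCycle.refl]⟩
  simp only [Finset.mem_filter, Finset.mem_univ, true_and] at hx hmin
  have hx' : t x < t (rot⁻¹ x) := by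
    refine lt_of_le_of_ne (hmin _ (Equiv.Perm.sameCycle_symm_apply_right.2 hx)) ?_
    have := h.ne (rot⁻¹ x)
    rwa [perm_apply_inv_self] at this
  rw [Finset.sum_eq_single x]
  · rw [if_pos hx']
  · intro y hy hyx
    simp only [Finset.mem_filter, Finset.mem_univ, true_and] at hy
    rw [if_neg]
    intro hlt
    have hyx' : rot.SameCycle y x := hy.symm.trans hx
    have := h.desc (rot⁻¹ y) x (Equiv.Perm.sameCycle_symm_apply_left.2 hyx')
    rw [perm_apply_inv_self] at this
    exact hyx (h.inj y x hyx' (le_antisymm (this hlt).1 (hmin y hy)))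
  · intro hn
    exact absurd (by simpa using hx) hn

/-- The windings of the zigzag paths in polar coordinates, their angles being measured
counterclockwise from a ray with angle `base`. -/
structure PolarChart {E : Type*} [Fintype E] (D : Dimer E) where
  base : ℝ
  t : E → ℝ
  len : E → ℝ
  t_pos : ∀ e, 0 < t e
  t_lt : ∀ e, t e < 2 * Real.pi
  len_pos : ∀ e, 0 < len e
  meanWinding_eq : ∀ e, D.meanWinding e = len e • unitVec (base + t e)
  t_zigzagStep : ∀ e, t (D.zigzagStep e) = t e
  rotW_ordered : AngleOrdered D.rotW t
  rotB_ordered : AngleOrdered D.rotB t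

namespace PolarChart

open Dimer

variable {E : Type*} [Fintype E] {D : Dimer E} (P : PolarChart D)

/-- The unit vector at a counterclockwise angle from the base ray. -/
noncomputable def vec (θ : ℝ) : ℝ × ℝ := unitVec (P.base + θ)

theorem wedge_vec (a b : ℝ) :
    wedge (P.vec a) (P.vec b) = Real.sin (b - a) := by
  rw [vec, vec, wedge_unitVec]; congr 1; ring

theorem wedge_vec_meanWinding (a : ℝ) (e : E) :
    wedge (P.vec a) (D.meanWinding e) = P.len e * Real.sin (P.t e - a) := by
  rw [P.meanWinding_eq, wedge_smul_right, ← P.wedge_vec]; rfl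

theorem wedge_vec_sum (a : ℝ) (χ : E → ℝ) :
    wedge (P.vec a) (∑ x, χ x • D.meanWinding x) =
      ∑ x, χ x * (P.len x * Real.sin (P.t x - a)) := by
  rw [wedge_sum_right]
  exact Finset.sum_congr rfl fun x _ => by rw [wedge_smul_right, wedge_vec_meanWinding]

/-- The zigzag paths whose angle is less than `s`. -/
noncomputable def below (s : ℝ) (e : E) : ℝ := if P.t e < s then 1 else 0

/-- The zigzag paths whose angle is `θ`. -/
noncomputable def at' (θ : ℝ) (e : E) : ℝ := if P.t e = θ then 1 else 0

theorem below_zigzagStep (s : ℝ) (e : E) : P.below s (D.zigzagStep e) = P.below s e := by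
  rw [below, below, P.t_zigzagStep]

theorem at'_zigzagStep (s : ℝ) (e : E) : P.at' s (D.zigzagStep e) = P.at' s e := by
  rw [at', at', P.t_zigzagStep]

/-- The matching of the base ray. -/
noncomputable def baseMatching (e : E) : ℝ := if P.t e < P.t (D.rotW⁻¹ e) then 1 else 0

/-- The matching of the ray at a counterclockwise angle `s` from the base ray. -/
noncomputable def matching (s : ℝ) : E → ℝ := D.zigzagFlip P.baseMatching (P.below s)

theorem t_rotB_inv (e : E) : P.t (D.rotB⁻¹ e) = P.t (D.rotW⁻¹ e) := by
  rw [← zigzagStep_rotW_inv, P.t_zigzagStep]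

theorem t_rotW_inv_ne (e : E) : P.t (D.rotW⁻¹ e) ≠ P.t e := by
  have := P.rotW_ordered.ne (D.rotW⁻¹ e)
  rw [perm_apply_inv_self] at this
  exact this.symm

theorem matching_apply (s : ℝ) (e : E) : P.matching s e =
    (if P.t e < P.t (D.rotW⁻¹ e) then 1 else 0) + (if P.t (D.rotW⁻¹ e) < s then 1 else 0) -
      (if P.t e < s then 1 else 0) := rfl

theorem isFractional_matching (s : ℝ) : D.IsFractional (P.matching s) where
  nonneg e := by
    -- If `t e < s` makes the last term count, then either `t (rotW⁻¹ e) < s` or `t e < s ≤ t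
    -- (rotW⁻¹ e)`, and a positive term compensates.
    rw [matching_apply]
    split_ifs <;> first | (exfalso; linarith) | norm_num
  white := D.zigzagFlip_white P.rotW_ordered.nodeSumsOne _
  black := by
    refine D.zigzagFlip_black ?_ _ (P.below_zigzagStep s)
    have h := P.rotB_ordered.nodeSumsOne
    simp only [P.t_rotB_inv] at h
    exact h

theorem totalDisp_matching (s : ℝ) : D.totalDisp (P.matching s) =
    D.totalDisp P.baseMatching + ∑ x, P.below s x • D.meanWinding x :=
  D.totalDisp_zigzagFlip _ _ (P.below_zigzagStep s)

theorem matching_of_forall_le {s : ℝ} (h : ∀ e, s ≤ P.t e) : P.matching s = P.baseMatching := by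
  funext e
  rw [matching_apply, if_neg (h _).not_gt, if_neg (h _).not_gt, baseMatching]
  ring

theorem isFractional_baseMatching : D.IsFractional P.baseMatching := by
  rw [← P.matching_of_forall_le fun e => (P.t_pos e).le]
  exact P.isFractional_matching 0

/-- At each visit of a white node by a zigzag path of angle `θ`, the matching uses one of the two
edges of the path. -/
def Tight (m : E → ℝ) (θ : ℝ) : Prop := ∀ x, P.t x = θ → m x + m (D.rotW x) = 1

theorem rotW_ne (P : PolarChart D) (x : E) : x ≠ D.rotW x := fun h => P.rotW_ordered.ne x (by rw [← h])

theorem add_rotW_le (P : PolarChart D) {m : E → ℝ} (hm : D.IsFractional m) (x : E) : m x + m (D.rotW x) ≤ 1 :=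
  hm.white.add_le_one hm.nonneg (P.rotW_ne x)
    (Equiv.Perm.sameCycle_apply_right.2 (Equiv.Perm.SameCycle.refl _ _))

theorem rotW_add_zigzagStep_le (P : PolarChart D) {m : E → ℝ} (hm : D.IsFractional m) (x : E) :
    m (D.rotW x) + m (D.zigzagStep x) ≤ 1 := by
  have h1 : D.rotB⁻¹ (D.rotW x) = D.zigzagStep x := rfl
  refine hm.black.add_le_one hm.nonneg (fun h => ?_) ?_
  · have := P.rotB_ordered.ne (D.zigzagStep x)
    rw [rotB_zigzagStep, h] at this
    exact this rfl
  · rw [← h1]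
    exact Equiv.Perm.sameCycle_symm_apply_right.2 (Equiv.Perm.SameCycle.refl _ _)

theorem at'_mul_le {m : E → ℝ} (hm : D.IsFractional m) (θ : ℝ) (x : E) :
    P.at' θ x * (m x + m (D.rotW x)) ≤ P.at' θ x := by
  have := P.add_rotW_le hm x
  unfold at'
  split_ifs <;> linarith

theorem sum_at'_eq_iff_tight {m : E → ℝ} (hm : D.IsFractional m) (θ : ℝ) :
    ∑ x, P.at' θ x * (m x + m (D.rotW x)) = ∑ x, P.at' θ x ↔ P.Tight m θ := by
  rw [Finset.sum_eq_sum_iff_of_le fun x _ => P.at'_mul_le hm θ x]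
  refine ⟨fun h x hx => ?_, fun h x _ => ?_⟩
  · simpa [at', hx] using h x (Finset.mem_univ x)
  · by_cases hx : P.t x = θ
    · simp [at', hx, h x hx]
    · simp [at', hx]

/-- The weights of the pairs at black turns have the same sum along the paths as those at white
turns. Tightness makes this sum maximal, so the black pairs also have weight one and `m` alternates
along each path. -/
theorem Tight.zigzagStep {P : PolarChart D} {m : E → ℝ} {θ : ℝ} (h : P.Tight m θ)
    (hm : D.IsFractional m) {x : E} (hx : P.t x = θ) : m (D.zigzagStep x) = m x := by
  have h1 := (P.sum_at'_eq_iff_tight hm θ).2 h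
  have h2 : ∑ x, P.at' θ x * (m (D.rotW x) + m (D.zigzagStep x)) = ∑ x, P.at' θ x := by
    rw [← h1]
    simp only [mul_add, Finset.sum_add_distrib]
    rw [add_comm, ← Equiv.sum_comp D.zigzagStep (fun x => P.at' θ x * m x)]
    simp only [P.at'_zigzagStep]
  have h3 := (Finset.sum_eq_sum_iff_of_le fun x _ => by
    have := P.rotW_add_zigzagStep_le hm x
    unfold at'
    split_ifs <;> linarith).1 h2 x (Finset.mem_univ x)
  simp only [at', hx, if_true, one_mul] at h3
  linarith [h x hx]

theorem Tight.rotW_zigzagStep {P : PolarChart D} {m : E → ℝ} {θ : ℝ} (h : P.Tight m θ)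
    (hm : D.IsFractional m) {x : E} (hx : P.t x = θ) :
    m (D.rotW (D.zigzagStep x)) = m (D.rotW x) := by
  have h1 := h x hx
  have h2 := h (D.zigzagStep x) (by rw [P.t_zigzagStep, hx])
  have h3 := h.zigzagStep hm hx
  linarith

theorem sum_at'_smul (θ : ℝ) : ∑ x, P.at' θ x • D.meanWinding x =
    (∑ x, P.at' θ x * P.len x) • P.vec θ := by
  rw [Finset.sum_smul]
  refine Finset.sum_congr rfl fun x _ => ?_
  by_cases hx : P.t x = θ
  · rw [P.meanWinding_eq, smul_smul, hx]; rfl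
  · simp [at', hx]

theorem sum_at'_mul_len_pos {θ : ℝ} (hθ : ∃ x, P.t x = θ) : 0 < ∑ x, P.at' θ x * P.len x := by
  obtain ⟨x, hx⟩ := hθ
  refine Finset.sum_pos' (fun y _ => ?_) ⟨x, Finset.mem_univ x, ?_⟩
  · have := (P.len_pos y).le
    unfold at'
    split_ifs <;> linarith
  · simpa [at', hx] using P.len_pos x

/-- The intersection formula applied to all paths at angle `θ`: the wedge measures how far `m` is
from being tight there. -/
theorem wedge_vec_eq {m m' : E → ℝ} (hm : D.IsFractional m) (hm' : D.IsFractional m') {θ : ℝ}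
    (h' : P.Tight m' θ) : (∑ x, P.at' θ x * P.len x) *
      wedge (P.vec θ) (D.totalDisp m - D.totalDisp m') =
      ∑ x, P.at' θ x - ∑ x, P.at' θ x * (m x + m (D.rotW x)) := by
  have h1 := wedge_totalDisp_sub hm hm' _ (P.at'_zigzagStep θ)
  rw [(P.sum_at'_eq_iff_tight hm' θ).2 h', P.sum_at'_smul, wedge_comm_neg, wedge_smul_left] at h1
  linarith

theorem wedge_vec_nonneg {m m' : E → ℝ} (hm : D.IsFractional m) (hm' : D.IsFractional m') {θ : ℝ}
    (hθ : ∃ x, P.t x = θ) (h' : P.Tight m' θ) :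
    0 ≤ wedge (P.vec θ) (D.totalDisp m - D.totalDisp m') := by
  have h1 := P.wedge_vec_eq hm hm' h'
  have h2 := P.sum_at'_mul_len_pos hθ
  have h3 := Finset.sum_le_sum fun x (_ : x ∈ Finset.univ) => P.at'_mul_le hm θ x
  by_contra h
  nlinarith

theorem tight_of_wedge_vec_eq_zero {m m' : E → ℝ} (hm : D.IsFractional m)
    (hm' : D.IsFractional m') {θ : ℝ} (h' : P.Tight m' θ)
    (h0 : wedge (P.vec θ) (D.totalDisp m - D.totalDisp m') = 0) : P.Tight m θ := by
  have h1 := P.wedge_vec_eq hm hm' h'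
  rw [h0, mul_zero] at h1
  exact (P.sum_at'_eq_iff_tight hm θ).1 (by linarith)

/-- The matching at angle `s` is tight at `θ` if no other angle lies between `s` and `θ`. -/
theorem tight_matching {s θ : ℝ} (h : ∀ x, P.t x ≠ θ → (P.t x < θ ↔ P.t x < s)) :
    P.Tight (P.matching s) θ := by
  intro x hx
  have h1 := P.t_rotW_inv_ne x
  have h2 := P.rotW_ordered.ne x
  rw [hx] at h1 h2
  have h3 := h _ h1
  have h4 := h _ h2
  rw [matching_apply, matching_apply, perm_inv_apply_self, hx, ← if_congr h3 rfl rfl,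
    ← if_congr h4 rfl rfl]
  rcases h1.lt_or_gt with h1 | h1
  · rw [if_neg h1.not_gt, if_pos h1]; ring
  · rw [if_pos h1, if_neg h1.not_gt]; ring

/-- The matching at an angle before all windings is tight at the last one. -/
theorem tight_matching_of_last {s θ : ℝ} (hs : ∀ x, s ≤ P.t x) (hθ : ∀ x, P.t x ≤ θ) :
    P.Tight (P.matching s) θ := by
  intro x hx
  have h2 := P.rotW_ordered.ne x
  rw [hx] at h2
  rw [matching_apply, matching_apply, perm_inv_apply_self, hx, if_neg (hθ _).not_gt,
    if_neg (hs _).not_gt, if_neg (hx ▸ hs x).not_gt, if_pos (lt_of_le_of_ne (hθ _) h2),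
    if_neg (hs _).not_gt]
  ring

/-- Every edge comes once before and once after a turn at a white node, so the displacements cancel.
-/
theorem sum_meanWinding : ∑ x, D.meanWinding x = 0 := by
  have h := D.sum_smul_meanWinding (fun _ => 1) fun _ => rfl
  simp only [one_smul, Finset.sum_sub_distrib] at h
  rw [← h, Equiv.sum_comp D.rotW D.planeDisp, sub_self]

theorem sum_len_mul_sin (a : ℝ) : ∑ x, P.len x * Real.sin (P.t x - a) = 0 := by
  have h := P.wedge_vec_sum a (fun _ => 1)
  simp only [one_smul, one_mul, sum_meanWinding] at h
  rw [← h]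
  simp [wedge]

end PolarChart

/-! ### Extremality and uniqueness of the base matching -/

namespace PolarChart

open Dimer

variable {E : Type*} [Fintype E] {D : Dimer E} (P : PolarChart D)

/-- The directions of the windings do not all lie on a line. -/
def Spread : Prop := ∀ x, ∃ y, 0 < Real.sin (P.t x - P.t y)

/-- The windings balance: with zero total, they cannot lie on one side of a line unless all lie on
it. -/
theorem exists_sin_pos {a : ℝ} {x : E} (h : Real.sin (P.t x - a) ≠ 0) :
    ∃ y, 0 < Real.sin (a - P.t y) := by
  by_contra! hc
  have hnn : ∀ y ∈ Finset.univ, 0 ≤ P.len y * Real.sin (P.t y - a) := fun y _ => by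
    have := hc y
    rw [← neg_sub, Real.sin_neg] at this
    exact mul_nonneg (P.len_pos y).le (by linarith)
  have := (Finset.sum_eq_zero_iff_of_nonneg hnn).1 (P.sum_len_mul_sin a) x (Finset.mem_univ x)
  exact h ((mul_eq_zero.1 this).resolve_left (P.len_pos x).ne')

theorem spread_or_collinear : P.Spread ∨ ∀ x y, Real.sin (P.t x - P.t y) = 0 := by
  by_cases h : ∀ x y, Real.sin (P.t x - P.t y) = 0
  · exact Or.inr h
  · left
    push Not at h
    obtain ⟨x, y, hxy⟩ := h
    intro z
    by_contra! hc
    have h1 : ∀ w, Real.sin (P.t w - P.t z) = 0 := fun w => by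
      by_contra hw
      obtain ⟨v, hv⟩ := P.exists_sin_pos hw
      exact absurd (hc v) hv.not_ge
    apply hxy
    have : P.t x - P.t y = (P.t x - P.t z) - (P.t y - P.t z) := by ring
    rw [this, Real.sin_sub, h1, h1]
    ring

theorem sin_pos_of_lt {a b : ℝ} (h : b < a) (h' : a < b + Real.pi) : 0 < Real.sin (a - b) :=
  Real.sin_pos_of_pos_of_lt_pi (by linarith) (by linarith)

theorem sin_pos_of_add_lt {a b : ℝ} (h : a + Real.pi < b) (h' : b < a + 2 * Real.pi) :
    0 < Real.sin (a - b) := by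
  rw [← Real.sin_add_two_pi]
  exact Real.sin_pos_of_pos_of_lt_pi (by linarith) (by linarith)

theorem lt_of_sin_pos {a b : ℝ} (h : 0 < Real.sin (a - b)) :
    (b < a ∧ a < b + 2 * Real.pi → a < b + Real.pi) ∧ (a ≤ b → a + Real.pi < b) := by
  constructor
  · rintro ⟨h1, h2⟩
    by_contra! hc
    have := Real.sin_nonpos_of_nonpos_of_neg_pi_le (x := a - b - 2 * Real.pi) (by linarith)
      (by linarith)
    rw [Real.sin_sub_two_pi] at this
    linarith
  · intro h1
    by_contra! hc
    have := Real.sin_nonpos_of_nonpos_of_neg_pi_le (x := a - b) (by linarith) (by linarith)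
    linarith

/-- If the windings are spread, there is a previous winding at an angle less than `π`, at which
the matching just before a given winding is still tight. -/
theorem Spread.exists_previous {P : PolarChart D} (h : P.Spread) (x : E) :
    ∃ y, 0 < Real.sin (P.t x - P.t y) ∧ P.Tight (P.matching (P.t x)) (P.t y) ∧
      ((∀ z, P.t x ≤ P.t z) → ∀ z, P.t z ≤ P.t y) := by
  obtain ⟨v, hv⟩ := h x
  have hx0 := P.t_pos x
  have hxl := P.t_lt x
  have hv0 := P.t_pos v
  have hvl := P.t_lt v
  obtain ⟨hv1, hv2⟩ := lt_of_sin_pos hv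
  by_cases hmin : ∀ z, P.t x ≤ P.t z
  · obtain ⟨y, -, hy⟩ := Finset.exists_max_image Finset.univ P.t ⟨x, Finset.mem_univ x⟩
    refine ⟨y, ?_, P.tight_matching_of_last hmin fun z => hy z (Finset.mem_univ z),
      fun _ z => hy z (Finset.mem_univ z)⟩
    have := hy v (Finset.mem_univ v)
    have := hv2 (hmin v)
    have := P.t_lt y
    exact sin_pos_of_add_lt (by linarith) (by linarith)
  · push Not at hmin
    obtain ⟨z, hz⟩ := hmin
    obtain ⟨y, hy, hmax⟩ := Finset.exists_max_image (Finset.univ.filter fun z => P.t z < P.t x)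
      P.t ⟨z, by simpa using hz⟩
    simp only [Finset.mem_filter, Finset.mem_univ, true_and] at hy hmax
    refine ⟨y, ?_, P.tight_matching fun w hw => ⟨fun h => h.trans hy, fun h =>
      lt_of_le_of_ne (hmax w h) hw⟩, fun h => absurd (h z) (not_le.2 hz)⟩
    refine sin_pos_of_lt hy ?_
    have hy0 := P.t_pos y
    by_cases hvx : P.t v < P.t x
    · have := hmax v hvx
      have := hv1 ⟨hvx, by linarith⟩
      linarith
    · have := hv2 (not_lt.1 hvx)
      linarith

/-- Let `m` be tight at the angle of `x` and have the total displacement of a matching that is tight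
at an angle less than `π` before.  Then `m` uses the edges before the turns of the zigzag paths at
the angle of `x`: flipping the paths where it uses the edges after the turns would lead beyond the
bound at the other angle. -/
theorem eq_one_of_tight {m m' : E → ℝ} (hm : D.IsFractional m) (hm' : D.IsFractional m')
    (hD : D.totalDisp m = D.totalDisp m') {x y : E} (ht : P.Tight m (P.t x))
    (hy : P.Tight m' (P.t y)) (hsin : 0 < Real.sin (P.t x - P.t y)) : m x = 1 := by
  set χ : E → ℝ := fun z => if P.t z = P.t x then -m (D.rotW z) else 0 with hχ
  -- Tightness makes `m (rotW z)` constant along the paths at the angle of `x`, so the flip is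
  -- admissible; it moves this weight back from the edge after each turn to the edge before.
  have hinv : ∀ z, χ (D.zigzagStep z) = χ z := by
    intro z
    simp only [hχ, P.t_zigzagStep]
    by_cases hz : P.t z = P.t x
    · simp only [if_pos hz, ht.rotW_zigzagStep hm hz]
    · simp only [if_neg hz]
  have hfr : D.IsFractional (D.zigzagFlip m χ) := by
    refine ⟨fun e => ?_, D.zigzagFlip_white hm.white χ, D.zigzagFlip_black hm.black χ hinv⟩
    have h0 := hm.nonneg e
    have h1 := hm.nonneg (D.rotW e)
    have h2 := P.t_rotW_inv_ne e
    simp only [zigzagFlip, hχ, perm_apply_inv_self]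
    by_cases he : P.t e = P.t x
    · rw [if_neg (fun h => h2 (h.trans he.symm)), if_pos he]
      linarith
    · rw [if_neg he]
      split_ifs <;> linarith
  have h1 := P.wedge_vec_nonneg hfr hm' ⟨y, rfl⟩ hy
  rw [D.totalDisp_zigzagFlip m χ hinv, hD, add_sub_cancel_left, P.wedge_vec_sum] at h1
  have hle : ∀ z ∈ Finset.univ, χ z * (P.len z * Real.sin (P.t z - P.t y)) ≤ 0 := by
    intro z _
    simp only [hχ]
    split_ifs with hz
    · rw [hz]
      have := mul_nonneg (hm.nonneg (D.rotW z)) (mul_pos (P.len_pos z) hsin).le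
      linarith
    · simp
  have h2 := (Finset.sum_eq_zero_iff_of_nonpos hle).1
    (le_antisymm (Finset.sum_nonpos hle) h1) x (Finset.mem_univ x)
  simp only [hχ, if_true] at h2
  have h3 : m (D.rotW x) = 0 := by
    rcases mul_eq_zero.1 h2 with h | h
    · linarith
    · exact absurd h (mul_pos (P.len_pos x) hsin).ne'
  have := ht x rfl
  linarith

/-- The flips that turn the base matching into the later ray matchings can be performed on `m` as
well. The induction adds one angle at a time; only nonnegativity is at stake. -/
theorem Spread.isFractional_zigzagFlip {P : PolarChart D} (h : P.Spread) {m : E → ℝ}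
    (hm : D.IsFractional m) (hD : D.totalDisp m = D.totalDisp P.baseMatching) (n : ℕ) :
    ∀ s : ℝ, (Finset.univ.filter fun x => P.t x < s).card ≤ n →
      D.IsFractional (D.zigzagFlip m (P.below s)) := by
  induction n with
  | zero =>
    intro s hs
    have hs' : P.below s = fun _ => 0 := by
      funext e
      rw [Nat.le_zero, Finset.card_eq_zero, Finset.filter_eq_empty_iff] at hs
      exact if_neg (hs (Finset.mem_univ e))
    have : D.zigzagFlip m (P.below s) = m := by
      funext e
      simp only [zigzagFlip, hs']
      ring
    rwa [this]
  | succ n ih =>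
    intro s hs
    by_cases hne : ∃ z, P.t z < s
    swap
    · refine ih s (le_of_eq_of_le (Finset.card_eq_zero.2 ?_) n.zero_le)
      rw [Finset.filter_eq_empty_iff]
      exact fun z _ hz => hne ⟨z, hz⟩
    obtain ⟨z, hz⟩ := hne
    obtain ⟨x, hx, hmax⟩ := Finset.exists_max_image (Finset.univ.filter fun z => P.t z < s)
      P.t ⟨z, by simpa using hz⟩
    simp only [Finset.mem_filter, Finset.mem_univ, true_and] at hx hmax
    have hcard : (Finset.univ.filter fun z => P.t z < P.t x).card <
        (Finset.univ.filter fun z => P.t z < s).card := by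
      refine Finset.card_lt_card ((Finset.ssubset_iff_of_subset fun w hw => ?_).2 ⟨x, ?_, ?_⟩)
      · simp only [Finset.mem_filter, Finset.mem_univ, true_and] at hw ⊢
        exact hw.trans hx
      · simpa using hx
      · simp
    have hfr := ih (P.t x) (by omega)
    -- The flipped `m` has the displacement of the ray matching at this stage, hence is tight at the
    -- current angle. The previous angle then forces weight one on the edges that the next flip
    -- empties.
    have hone : ∀ e, P.t e = P.t x → D.zigzagFlip m (P.below (P.t x)) e = 1 := by
      intro e he
      obtain ⟨y, hy1, hy2, -⟩ := h.exists_previous e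
      have hD' : D.totalDisp (D.zigzagFlip m (P.below (P.t e))) =
          D.totalDisp (P.matching (P.t e)) := by
        rw [D.totalDisp_zigzagFlip _ _ (P.below_zigzagStep _), hD, P.totalDisp_matching]
      rw [← he] at hfr ⊢
      have hfm := P.isFractional_matching (P.t e)
      refine P.eq_one_of_tight hfr hfm hD' (P.tight_of_wedge_vec_eq_zero hfr hfm
        (P.tight_matching fun _ _ => Iff.rfl) ?_) hy2 hy1
      rw [hD', sub_self]
      simp [wedge]
    refine ⟨fun e => ?_, D.zigzagFlip_white hm.white _,
      D.zigzagFlip_black hm.black _ (P.below_zigzagStep _)⟩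
    have hb : ∀ w, P.below s w = P.below (P.t x) w + if P.t w = P.t x then 1 else 0 := by
      intro w
      unfold below
      rcases lt_trichotomy (P.t w) (P.t x) with hw | hw | hw
      · rw [if_pos (hw.trans hx), if_pos hw, if_neg hw.ne, add_zero]
      · rw [if_pos (hw ▸ hx), if_neg hw.not_lt, if_pos hw, zero_add]
      · rw [if_neg fun hc => (hmax w hc).not_gt hw, if_neg hw.not_gt, if_neg hw.ne', add_zero]
    have h0 := hfr.nonneg e
    have h1 := hone e
    have h2 := P.t_rotW_inv_ne e
    simp only [zigzagFlip, hb] at h0 h1 ⊢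
    by_cases he : P.t e = P.t x
    · rw [if_neg (fun h => h2 (h.trans he.symm)), if_pos he]
      linarith [h1 he]
    · rw [if_neg he]
      split_ifs <;> linarith

/-- By equality of node sums it suffices that `m` is at least one on each edge of the base matching.
Flipping all paths below the angle of such an edge leaves its weight unchanged, and the flipped
weight is one. -/
theorem Spread.eq_baseMatching {P : PolarChart D} (h : P.Spread) {m : E → ℝ}
    (hm : D.IsFractional m) (hD : D.totalDisp m = D.totalDisp P.baseMatching) :
    m = P.baseMatching := by
  refine (P.isFractional_baseMatching.white.eq_of_le hm.white fun e => ?_).symm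
  rw [baseMatching]
  split_ifs with he
  swap
  · exact hm.nonneg e
  have hfr := h.isFractional_zigzagFlip hm hD _ (P.t e) le_rfl
  obtain ⟨y, hy1, hy2, -⟩ := h.exists_previous e
  have hD' : D.totalDisp (D.zigzagFlip m (P.below (P.t e))) =
      D.totalDisp (P.matching (P.t e)) := by
    rw [D.totalDisp_zigzagFlip _ _ (P.below_zigzagStep _), hD, P.totalDisp_matching]
  have hfm := P.isFractional_matching (P.t e)
  have := P.eq_one_of_tight hfr hfm hD' (P.tight_of_wedge_vec_eq_zero hfr hfm
    (P.tight_matching fun _ _ => Iff.rfl) (by rw [hD', sub_self]; simp [wedge])) hy2 hy1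
  rw [zigzagFlip, below, below, if_neg he.not_gt, if_neg (lt_irrefl _)] at this
  linarith

/-- The base ray lies between the last and the first winding, whose gap is less than `π`, so it is a
positive combination of the two. The base matching is tight at both, which bounds the displacement;
equality forces both wedges to vanish, hence equal displacements. -/
theorem Spread.support {P : PolarChart D} [Nonempty E] (h : P.Spread) {m : E → ℝ}
    (hm : D.IsFractional m) :
    0 ≤ wedge (P.vec 0) (D.totalDisp m - D.totalDisp P.baseMatching) ∧
      (wedge (P.vec 0) (D.totalDisp m - D.totalDisp P.baseMatching) = 0 →
        m = P.baseMatching) := by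
  obtain ⟨x, -, hx⟩ := Finset.exists_min_image Finset.univ P.t Finset.univ_nonempty
  have hx' : ∀ z, P.t x ≤ P.t z := fun z => hx z (Finset.mem_univ z)
  obtain ⟨y, hy1, hy2, hy3⟩ := h.exists_previous x
  have hbase := P.matching_of_forall_le hx'
  have htx : P.Tight P.baseMatching (P.t x) := by
    rw [← hbase]; exact P.tight_matching fun _ _ => Iff.rfl
  rw [hbase] at hy2
  have hb := P.isFractional_baseMatching
  have h1 := P.wedge_vec_nonneg hm hb ⟨x, rfl⟩ htx
  have h2 := P.wedge_vec_nonneg hm hb ⟨y, rfl⟩ hy2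
  have hpi := Real.pi_pos
  have hxpos := P.t_pos x
  have hylt := P.t_lt y
  have hgap := (lt_of_sin_pos hy1).2 (hx' y)
  have hsx : 0 < Real.sin (P.t x) := Real.sin_pos_of_pos_of_lt_pi hxpos (by linarith)
  have hsy : 0 < -Real.sin (P.t y) := by
    have := Real.sin_neg_of_neg_of_neg_pi_lt (x := P.t y - 2 * Real.pi) (by linarith) (by linarith)
    rw [Real.sin_sub_two_pi] at this
    linarith
  set X := D.totalDisp m - D.totalDisp P.baseMatching with hX
  have wxy : wedge (P.vec (P.t y)) (P.vec (P.t x)) = Real.sin (P.t x - P.t y) := P.wedge_vec _ _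
  have w0x : wedge (P.vec 0) (P.vec (P.t x)) = Real.sin (P.t x) := by rw [P.wedge_vec, sub_zero]
  have w0y : wedge (P.vec 0) (P.vec (P.t y)) = Real.sin (P.t y) := by rw [P.wedge_vec, sub_zero]
  have key : Real.sin (P.t x - P.t y) * wedge (P.vec 0) X =
      -Real.sin (P.t y) * wedge (P.vec (P.t x)) X +
        Real.sin (P.t x) * wedge (P.vec (P.t y)) X := by
    rw [← wxy, ← w0x, ← w0y]
    simp only [wedge]
    ring
  have n1 := mul_nonneg hsy.le h1
  have n2 := mul_nonneg hsx.le h2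
  refine ⟨by_contra fun hc => ?_, fun h0 => h.eq_baseMatching hm ?_⟩
  · have := mul_neg_of_pos_of_neg hy1 (not_le.1 hc)
    linarith
  · rw [h0, mul_zero] at key
    have z1 : wedge (P.vec (P.t x)) X = 0 :=
      (mul_eq_zero.1 (show -Real.sin (P.t y) * wedge (P.vec (P.t x)) X = 0 by
        linarith)).resolve_left hsy.ne'
    have z2 : wedge (P.vec (P.t y)) X = 0 :=
      (mul_eq_zero.1 (show Real.sin (P.t x) * wedge (P.vec (P.t y)) X = 0 by
        linarith)).resolve_left hsx.ne'
    rw [← wxy] at hy1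
    have e1 : X.1 * wedge (P.vec (P.t y)) (P.vec (P.t x)) = 0 := by
      have : X.1 * wedge (P.vec (P.t y)) (P.vec (P.t x)) = (P.vec (P.t y)).1 *
        wedge X (P.vec (P.t x)) - (P.vec (P.t x)).1 * wedge X (P.vec (P.t y)) := by
        simp only [wedge]; ring
      rw [this, wedge_comm_neg X, wedge_comm_neg X, z1, z2]; ring
    have e2 : X.2 * wedge (P.vec (P.t y)) (P.vec (P.t x)) = 0 := by
      have : X.2 * wedge (P.vec (P.t y)) (P.vec (P.t x)) = (P.vec (P.t y)).2 *
        wedge X (P.vec (P.t x)) - (P.vec (P.t x)).2 * wedge X (P.vec (P.t y)) := by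
        simp only [wedge]; ring
      rw [this, wedge_comm_neg X, wedge_comm_neg X, z1, z2]; ring
    have : X = 0 := Prod.ext ((mul_eq_zero.1 e1).resolve_right hy1.ne')
      ((mul_eq_zero.1 e2).resolve_right hy1.ne')
    exact sub_eq_zero.1 this

/-- There are only two opposite directions, and tightness of the base matching at both gives
opposite inequalities. So `m` is tight too, and is a nonnegative flip of the base matching along the
paths of the first direction. This moves the displacement strictly to one side of the ray unless the
flip is trivial. -/
theorem support_of_collinear [Nonempty E] (h : ∀ x y, Real.sin (P.t x - P.t y) = 0) {m : E → ℝ}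
    (hm : D.IsFractional m) :
    0 ≤ wedge (P.vec 0) (D.totalDisp m - D.totalDisp P.baseMatching) ∧
      (wedge (P.vec 0) (D.totalDisp m - D.totalDisp P.baseMatching) = 0 →
        m = P.baseMatching) := by
  obtain ⟨x, -, hx⟩ := Finset.exists_min_image Finset.univ P.t Finset.univ_nonempty
  have hx' : ∀ z, P.t x ≤ P.t z := fun z => hx z (Finset.mem_univ z)
  have hval : ∀ z, P.t z ≠ P.t x → P.t z = P.t x + Real.pi := by
    intro z hz
    have h1 := lt_of_le_of_ne (hx' z) hz.symm
    have h2 := P.t_lt z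
    have h3 := P.t_pos x
    have h4 := h z x
    rcases lt_trichotomy (P.t z) (P.t x + Real.pi) with hlt | heq | hgt
    · exact absurd h4 (sin_pos_of_lt h1 hlt).ne'
    · exact heq
    · have := sin_pos_of_add_lt hgt (by linarith)
      rw [← neg_sub, Real.sin_neg, h4] at this
      simp at this
  have hbase := P.matching_of_forall_le hx'
  have htx : P.Tight P.baseMatching (P.t x) := by
    rw [← hbase]; exact P.tight_matching fun _ _ => Iff.rfl
  have hy : P.t (D.rotW x) = P.t x + Real.pi := hval _ (P.rotW_ordered.ne x)
  have hty : P.Tight P.baseMatching (P.t (D.rotW x)) := by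
    rw [← hbase]
    refine P.tight_matching_of_last hx' fun z => ?_
    rw [hy]
    by_cases hz : P.t z = P.t x
    · rw [hz]; linarith [Real.pi_pos]
    · exact (hval z hz).le
  have hb := P.isFractional_baseMatching
  have h1 := P.wedge_vec_nonneg hm hb ⟨x, rfl⟩ htx
  have h2 := P.wedge_vec_nonneg hm hb ⟨_, rfl⟩ hty
  have hneg : P.vec (P.t (D.rotW x)) = (-1 : ℝ) • P.vec (P.t x) := by
    rw [hy, vec, vec, ← add_assoc, unitVec, unitVec, Real.cos_add_pi, Real.sin_add_pi]
    simp
  rw [hneg, wedge_smul_left] at h2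
  have ht := P.tight_of_wedge_vec_eq_zero hm hb htx (by linarith)
  set χ : E → ℝ := fun z => if P.t z = P.t x then m (D.rotW z) else 0 with hχ
  have hinv : ∀ z, χ (D.zigzagStep z) = χ z := by
    intro z
    simp only [hχ, P.t_zigzagStep]
    by_cases hz : P.t z = P.t x
    · simp only [if_pos hz, ht.rotW_zigzagStep hm hz]
    · simp only [if_neg hz]
  have hflip : m = D.zigzagFlip P.baseMatching χ := by
    funext e
    have h2 := P.t_rotW_inv_ne e
    simp only [zigzagFlip, hχ, perm_apply_inv_self, baseMatching]
    by_cases he : P.t e = P.t x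
    · rw [he] at h2
      rw [if_pos (by rw [he]; exact lt_of_le_of_ne (hx' _) h2.symm), if_neg h2, if_pos he]
      linarith [ht e he]
    · have h3 : P.t (D.rotW⁻¹ e) = P.t x := by
        by_contra h4
        exact h2 ((hval _ h4).trans (hval _ he).symm)
      rw [if_neg (by rw [h3]; exact (hx' _).not_gt), if_pos h3, if_neg he]
      ring
  have hD := D.totalDisp_zigzagFlip P.baseMatching χ hinv
  rw [← hflip] at hD
  have hsx : 0 < Real.sin (P.t x) := Real.sin_pos_of_pos_of_lt_pi (P.t_pos x)
    (by linarith [P.t_lt (D.rotW x)])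
  have hnn : ∀ z ∈ Finset.univ, 0 ≤ χ z * (P.len z * Real.sin (P.t z - 0)) := by
    intro z _
    simp only [hχ]
    split_ifs with hz
    · rw [hz, sub_zero]
      exact mul_nonneg (hm.nonneg _) (mul_pos (P.len_pos z) hsx).le
    · simp
  rw [hD, add_sub_cancel_left, P.wedge_vec_sum]
  refine ⟨Finset.sum_nonneg hnn, fun h0 => ?_⟩
  have h3 := (Finset.sum_eq_zero_iff_of_nonneg hnn).1 h0
  have h4 : ∀ z, χ z = 0 := by
    intro z
    have h5 := h3 z (Finset.mem_univ z)
    by_cases hz : P.t z = P.t x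
    · rw [hz, sub_zero] at h5
      exact (mul_eq_zero.1 h5).resolve_right (mul_pos (P.len_pos z) hsx).ne'
    · simp [hχ, hz]
  rw [hflip]
  funext e
  rw [zigzagFlip, h4, h4]
  ring

/-- The matching of the base ray is the only fractional matching that is extremal in the direction
of the ray. -/
theorem support [Nonempty E] {m : E → ℝ} (hm : D.IsFractional m) :
    0 ≤ wedge (P.vec 0) (D.totalDisp m - D.totalDisp P.baseMatching) ∧
      (wedge (P.vec 0) (D.totalDisp m - D.totalDisp P.baseMatching) = 0 →
        m = P.baseMatching) := by
  rcases P.spread_or_collinear with h | h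
  · exact h.support hm
  · exact P.support_of_collinear h hm

end PolarChart

/-! ### Sums of windings over sectors -/

namespace PolarChart

open Dimer

variable {E : Type*} [Fintype E] {D : Dimer E} (P : PolarChart D)

open Classical in
/-- The sum of the windings in a set of zigzag paths. -/
noncomputable def windingSum (D : Dimer E) (S : E → Prop) : ℝ × ℝ := ∑ x with S x, D.meanWinding x

theorem windingSum_of_forall_notMem {S : E → Prop} (h : ∀ x, ¬ S x) : windingSum D S = 0 := by
  classical
  rw [windingSum, Finset.filter_eq_empty_iff.2 fun x _ => h x, Finset.sum_empty]

theorem windingSum_add_windingSum {S S' T : E → Prop} (h : ∀ x, T x ↔ S x ∨ S' x)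
    (hd : ∀ x, ¬ (S x ∧ S' x)) : windingSum D S + windingSum D S' = windingSum D T := by
  classical
  rw [windingSum, windingSum, windingSum, ← Finset.sum_union]
  · congr 1
    ext x
    simp [h]
  · rw [Finset.disjoint_filter]
    exact fun x _ h1 h2 => hd x ⟨h1, h2⟩

theorem windingSum_of_forall_mem {S : E → Prop} (h : ∀ x, S x) : windingSum D S = 0 := by
  classical
  rw [windingSum, Finset.filter_true_of_mem fun x _ => h x, sum_meanWinding]

theorem exists_mem_of_windingSum_ne_zero {S : E → Prop} (h : windingSum D S ≠ 0) : ∃ x, S x := by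
  by_contra! hc
  exact h (windingSum_of_forall_notMem hc)

theorem totalDisp_matching_eq (s : ℝ) : D.totalDisp (P.matching s) =
    D.totalDisp P.baseMatching + windingSum D (fun x => P.t x < s) := by
  classical
  rw [P.totalDisp_matching, windingSum, Finset.sum_filter]
  congr 1
  refine Finset.sum_congr rfl fun x _ => ?_
  by_cases hx : P.t x < s <;> simp [below, hx]

theorem wedge_vec_windingSum_pos {S : E → Prop} (hS : ∃ x, S x) (a : ℝ)
    (h : ∀ x, S x → 0 < Real.sin (P.t x - a)) : 0 < wedge (P.vec a) (windingSum D S) := by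
  classical
  rw [windingSum, wedge_sum_right]
  obtain ⟨x, hx⟩ := hS
  refine Finset.sum_pos (fun y hy => ?_) ⟨x, by simpa using hx⟩
  rw [wedge_vec_meanWinding]
  exact mul_pos (P.len_pos y) (h y (by simpa using hy))

theorem wedge_windingSum_pos {S S' : E → Prop} (hS : ∃ x, S x) (hS' : ∃ x, S' x)
    (h : ∀ x, S x → ∀ y, S' y → 0 < Real.sin (P.t y - P.t x)) :
    0 < wedge (windingSum D S) (windingSum D S') := by
  classical
  rw [windingSum, wedge_sum_left]
  obtain ⟨x, hx⟩ := hS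
  refine Finset.sum_pos (fun y hy => ?_) ⟨x, by simpa using hx⟩
  rw [P.meanWinding_eq, wedge_smul_left]
  exact mul_pos (P.len_pos y) (P.wedge_vec_windingSum_pos hS' _ (h y (by simpa using hy)))

/-- The sector or its complement lies in an open half plane, where a nonempty sum cannot vanish; the
two sums are opposite. -/
theorem windingSum_lt_ne_zero {s : ℝ} (h1 : ∃ x, P.t x < s) (h2 : ∃ x, s < P.t x)
    (hs : ∀ x, P.t x ≠ s) : windingSum D (fun x => P.t x < s) ≠ 0 := by
  intro h0
  have hsum : windingSum D (fun x => P.t x < s) + windingSum D (fun x => s < P.t x) =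
      windingSum D (fun _ => True) := windingSum_add_windingSum
    (fun x => by simpa using (hs x).lt_or_gt) fun x hx => lt_asymm hx.1 hx.2
  rw [windingSum_of_forall_mem fun _ => trivial, h0, zero_add] at hsum
  by_cases hpi : s ≤ Real.pi
  · have := P.wedge_vec_windingSum_pos (S := (fun x => P.t x < s)) h1 0 fun x hx => by
      have hx : P.t x < s := hx
      exact sin_pos_of_lt (P.t_pos x) (by linarith)
    rw [h0] at this
    simp [wedge] at this
  · have := P.wedge_vec_windingSum_pos (S := (fun x => s < P.t x)) h2 Real.pi fun x hx => by
      have hx : s < P.t x := hx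
      have := P.t_lt x
      exact sin_pos_of_lt (by linarith) (by linarith)
    rw [hsum] at this
    simp [wedge] at this

/-- If three vectors with sum zero lie in the successive open sectors of three rays, all sectors
being less than half planes, then they form a positively oriented triangle. -/
theorem wedge_pos_of_sectors {r s t A B C : ℝ × ℝ} (hrs : 0 < wedge r s) (hst : 0 < wedge s t)
    (htr : 0 < wedge t r) (hrA : 0 < wedge r A) (hAs : 0 < wedge A s) (hsB : 0 < wedge s B)
    (hBt : 0 < wedge B t) (htC : 0 < wedge t C) (hCr : 0 < wedge C r) (h0 : A + B + C = 0) :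
    0 < wedge A B := by
  have hC : C = -A - B := by
    rw [← sub_eq_zero, ← h0]; abel
  have hBC : wedge B C = wedge A B := by
    rw [hC]; simp only [wedge, Prod.fst_sub, Prod.snd_sub, Prod.fst_neg, Prod.snd_neg]; ring
  have e1 : wedge r s * wedge s t * wedge A B = wedge A s * wedge B t * wedge r s +
      wedge r A * wedge s B * wedge s t - wedge A s * wedge s B * wedge t r := by
    simp only [wedge]; ring
  have e2 : wedge s t * wedge t r * wedge B C = wedge B t * wedge C r * wedge s t -
      wedge B t * wedge t C * wedge r s + wedge s B * wedge t C * wedge t r := by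
    simp only [wedge]; ring
  rw [hBC] at e2
  by_contra! hK
  have k1 := mul_nonpos_of_nonneg_of_nonpos (mul_pos hrs hst).le hK
  have k2 := mul_nonpos_of_nonneg_of_nonpos (mul_pos hst htr).le hK
  have p1 := mul_pos (mul_pos hrA hsB) hst
  have p2 := mul_pos (mul_pos hBt hCr) hst
  have l1 : 0 < wedge A s * (wedge s B * wedge t r - wedge B t * wedge r s) := by
    linarith
  have l2 : 0 < wedge t C * (wedge B t * wedge r s - wedge s B * wedge t r) := by
    linarith
  have m1 := (mul_pos_iff_of_pos_left hAs).1 l1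
  have m2 := (mul_pos_iff_of_pos_left htC).1 l2
  linarith

/-- The two rays and the base ray cut the windings into three sums with total zero, so `A ∧ B = B ∧
C = C ∧ A`. If some sector has angle at least `π`, the other two fit in a half plane and their wedge
is a sum of positive terms; otherwise `wedge_pos_of_sectors` applies. -/
theorem wedge_windingSum_lt_pos {σ τ : ℝ} (hσ : 0 < σ) (hστ : σ < τ)
    (hσ' : ∀ x, P.t x ≠ σ) (hτ' : ∀ x, P.t x ≠ τ) (h1 : windingSum D (fun x => P.t x < σ) ≠ 0)
    (h2 : windingSum D (fun x => P.t x < τ) ≠ 0)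
    (h3 : windingSum D (fun x => P.t x < σ) ≠ windingSum D (fun x => P.t x < τ)) :
    0 < wedge (windingSum D (fun x => P.t x < σ)) (windingSum D (fun x => P.t x < τ)) := by
  set A := windingSum D (fun x => P.t x < σ) with hA
  set B := windingSum D (fun x => σ < P.t x ∧ P.t x < τ) with hB
  set C := windingSum D (fun x => τ < P.t x) with hC
  have hAB : A + B = windingSum D (fun x => P.t x < τ) := windingSum_add_windingSum
    (fun x => by
      rcases (hσ' x).lt_or_gt with h | h
      · exact ⟨fun _ => Or.inl h, fun _ => h.trans hστ⟩
      · exact ⟨fun h' => Or.inr ⟨h, h'⟩, fun h' => h'.elim (fun h'' => h''.trans hστ) And.right⟩)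
    fun x hx => lt_asymm hx.1 hx.2.1
  have hABC : A + B + C = 0 := by
    rw [hAB, windingSum_add_windingSum (T := (fun _ => True))
      (fun x => by simpa using (hτ' x).lt_or_gt) fun x hx => lt_asymm hx.1 hx.2]
    exact windingSum_of_forall_mem fun _ => trivial
  rw [← hAB] at h2 h3 ⊢
  have hB0 : B ≠ 0 := fun h => h3 (by rw [h, add_zero])
  have hC0 : C ≠ 0 := fun h => h2 (by rw [← hABC, h, add_zero])
  have eA := exists_mem_of_windingSum_ne_zero h1
  have eB := exists_mem_of_windingSum_ne_zero hB0
  have eC := exists_mem_of_windingSum_ne_zero hC0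
  have hC' : C = -A - B := by
    rw [← sub_eq_zero, ← hABC]; abel
  have hgoal : wedge A (A + B) = wedge A B := by
    simp only [wedge, Prod.fst_add, Prod.snd_add]; ring
  have hBC : wedge B C = wedge A B := by
    rw [hC']; simp only [wedge, Prod.fst_sub, Prod.snd_sub, Prod.fst_neg, Prod.snd_neg]; ring
  have hCA : wedge C A = wedge A B := by
    rw [hC']; simp only [wedge, Prod.fst_sub, Prod.snd_sub, Prod.fst_neg, Prod.snd_neg]; ring
  rw [hgoal]
  by_cases c1 : τ ≤ Real.pi
  · refine P.wedge_windingSum_pos eA eB fun x hx y hy => ?_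
    have hx : P.t x < σ := hx
    have := P.t_pos x
    exact sin_pos_of_lt (hx.trans hy.1) (by linarith [hy.2])
  by_cases c2 : Real.pi ≤ σ
  · rw [← hBC]
    refine P.wedge_windingSum_pos eB eC fun x hx y hy => ?_
    have hy : τ < P.t y := hy
    have := P.t_lt y
    exact sin_pos_of_lt (hx.2.trans hy) (by linarith [hx.1])
  by_cases c3 : Real.pi ≤ τ - σ
  · rw [← hCA]
    refine P.wedge_windingSum_pos eC eA fun x hx y hy => ?_
    have hx : τ < P.t x := hx
    have hy : P.t y < σ := hy
    have := P.t_lt x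
    have := P.t_pos y
    exact sin_pos_of_add_lt (by linarith) (by linarith)
  push Not at c1 c2 c3
  refine wedge_pos_of_sectors (r := P.vec 0) (s := P.vec σ) (t := P.vec τ)
    ?_ ?_ ?_ ?_ ?_ ?_ ?_ ?_ ?_ hABC
  · rw [P.wedge_vec]
    exact sin_pos_of_lt hσ (by linarith)
  · rw [P.wedge_vec]
    exact sin_pos_of_lt hστ (by linarith)
  · rw [P.wedge_vec]
    exact sin_pos_of_add_lt (by linarith) (by linarith)
  · refine P.wedge_vec_windingSum_pos eA _ fun x hx => ?_
    have hx : P.t x < σ := hx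
    exact sin_pos_of_lt (P.t_pos x) (by linarith)
  -- The sign is absorbed by turning the ray through `π`, which reduces to the left-hand form of the
  -- inequality.
  · rw [wedge_comm_neg, neg_pos, ← neg_pos, ← neg_one_mul, ← wedge_smul_left]
    have : (-1 : ℝ) • P.vec σ = P.vec (σ + Real.pi) := by
      rw [vec, vec, ← add_assoc, unitVec, unitVec, Real.cos_add_pi, Real.sin_add_pi]
      simp
    rw [this]
    refine P.wedge_vec_windingSum_pos eA _ fun x hx => ?_
    have hx : P.t x < σ := hx
    have := P.t_pos x
    exact sin_pos_of_add_lt (by linarith) (by linarith)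
  · refine P.wedge_vec_windingSum_pos eB _ fun x hx => ?_
    exact sin_pos_of_lt hx.1 (by linarith [hx.2])
  · rw [wedge_comm_neg, neg_pos, ← neg_pos, ← neg_one_mul, ← wedge_smul_left]
    have : (-1 : ℝ) • P.vec τ = P.vec (τ - Real.pi) := by
      rw [vec, vec, ← add_sub_assoc, unitVec, unitVec, Real.cos_sub_pi, Real.sin_sub_pi]
      simp
    rw [this]
    refine P.wedge_vec_windingSum_pos eB _ fun x hx => ?_
    exact sin_pos_of_lt (by linarith [hx.1]) (by linarith [hx.2])
  · refine P.wedge_vec_windingSum_pos eC _ fun x hx => ?_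
    have hx : τ < P.t x := hx
    have := P.t_lt x
    exact sin_pos_of_lt hx (by linarith)
  · rw [wedge_comm_neg, neg_pos, ← neg_pos, ← neg_one_mul, ← wedge_smul_left]
    have : (-1 : ℝ) • P.vec 0 = P.vec Real.pi := by
      rw [vec, vec, unitVec, unitVec, Real.cos_add_pi, Real.sin_add_pi]
      simp
    rw [this]
    refine P.wedge_vec_windingSum_pos eC _ fun x hx => ?_
    have hx : τ < P.t x := hx
    have := P.t_lt x
    exact sin_pos_of_lt (by linarith) (by linarith)

end PolarChart

/-! ### Circular order in terms of counterclockwise angles -/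

/-- The counterclockwise angle from `a` to `b`, in `[0, 2π)`. -/
noncomputable def ccwAngle (a b : Real.Angle) : ℝ := toIcoMod Real.two_pi_pos 0 (b - a).toReal

theorem ccwAngle_nonneg (a b : Real.Angle) : 0 ≤ ccwAngle a b :=
  (toIcoMod_mem_Ico Real.two_pi_pos 0 _).1

theorem ccwAngle_lt (a b : Real.Angle) : ccwAngle a b < 2 * Real.pi := by
  have := (toIcoMod_mem_Ico Real.two_pi_pos 0 (b - a).toReal).2
  rwa [zero_add] at this

theorem toIcoMod_coe_angle (x : ℝ) : ((toIcoMod Real.two_pi_pos 0 x : ℝ) : Real.Angle) = x := by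
  rw [toIcoMod, Real.Angle.coe_sub, Real.Angle.coe_zsmul, Real.Angle.coe_two_pi, smul_zero,
    sub_zero]

theorem coe_ccwAngle (a b : Real.Angle) : (ccwAngle a b : Real.Angle) = b - a := by
  rw [ccwAngle, toIcoMod_coe_angle, Real.Angle.coe_toReal]

theorem eq_of_coe_eq {x y : ℝ} (hx : 0 ≤ x) (hx' : x < 2 * Real.pi) (hy : 0 ≤ y)
    (hy' : y < 2 * Real.pi) (h : (x : Real.Angle) = y) : x = y := by
  obtain ⟨k, hk⟩ := Real.Angle.angle_eq_iff_two_pi_dvd_sub.1 h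
  have hpi := Real.pi_pos
  have h1 : (k : ℝ) < 1 := by nlinarith
  have h2 : (-1 : ℝ) < k := by nlinarith
  have h3 : k = 0 := by
    have : k < 1 := by exact_mod_cast h1
    have : -1 < k := by exact_mod_cast h2
    omega
  rw [h3] at hk
  simp at hk
  linarith

theorem ccwAngle_eq_of_coe {a b : Real.Angle} {x : ℝ} (hx : 0 ≤ x) (hx' : x < 2 * Real.pi)
    (h : (x : Real.Angle) = b - a) : ccwAngle a b = x :=
  eq_of_coe_eq (ccwAngle_nonneg a b) (ccwAngle_lt a b) hx hx' ((coe_ccwAngle a b).trans h.symm)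

theorem ccwAngle_coe_coe (x y : ℝ) :
    ccwAngle (x : Real.Angle) (y : Real.Angle) = toIcoMod Real.two_pi_pos 0 (y - x) := by
  have h := toIcoMod_mem_Ico Real.two_pi_pos 0 (y - x)
  refine ccwAngle_eq_of_coe h.1 (by simpa using h.2) ?_
  rw [toIcoMod_coe_angle, Real.Angle.coe_sub]

theorem ccwAngle_injective {o a b : Real.Angle} (h : ccwAngle o a = ccwAngle o b) : a = b := by
  have h1 := coe_ccwAngle o a
  rw [h, coe_ccwAngle] at h1
  exact (sub_left_inj.1 h1).symm

theorem ccwAngle_self (a : Real.Angle) : ccwAngle a a = 0 :=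
  ccwAngle_eq_of_coe le_rfl Real.two_pi_pos (by simp)

theorem ccwAngle_pos {a b : Real.Angle} (h : a ≠ b) : 0 < ccwAngle a b :=
  lt_of_le_of_ne (ccwAngle_nonneg a b) fun h0 =>
    h (ccwAngle_injective (o := a) (by rw [ccwAngle_self, ← h0]))

theorem sbtw_iff_ccwAngle (a b c : Real.Angle) :
    sbtw a b c ↔ 0 < ccwAngle a b ∧ ccwAngle a b < ccwAngle a c := by
  induction a using Real.Angle.induction_on with | h x => ?_
  induction b using Real.Angle.induction_on with | h y => ?_
  induction c using Real.Angle.induction_on with | h z => ?_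
  have hbtw : btw (x : Real.Angle) (z : Real.Angle) (y : Real.Angle) ↔
      toIcoMod Real.two_pi_pos 0 (z - x) ≤ toIocMod Real.two_pi_pos 0 (y - x) :=
    QuotientAddGroup.btw_coe_iff' (hp' := ⟨Real.two_pi_pos⟩)
  rw [← sbtw_cyclic, sbtw_iff_not_btw, hbtw, not_le, ccwAngle_coe_coe, ccwAngle_coe_coe]
  have h1 := toIcoMod_mem_Ico Real.two_pi_pos 0 (y - x)
  have h2 := toIocMod_mem_Ioc Real.two_pi_pos 0 (y - x)
  have h3 := toIcoMod_mem_Ico Real.two_pi_pos 0 (z - x)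
  rw [zero_add] at h1 h2 h3
  have hcoe : ((toIcoMod Real.two_pi_pos 0 (y - x) : ℝ) : Real.Angle) =
      (toIocMod Real.two_pi_pos 0 (y - x) : ℝ) := by
    rw [toIcoMod_coe_angle, toIocMod, Real.Angle.coe_sub (y - x), Real.Angle.coe_zsmul,
      Real.Angle.coe_two_pi, smul_zero, sub_zero]
  -- The half-open representatives agree except for the zero angle, which becomes `2π` in one and
  -- `0` in the other; then both sides are false.
  rcases h2.2.lt_or_eq with h4 | h4
  · rw [eq_of_coe_eq h1.1 h1.2 h2.1.le h4 hcoe]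
    exact ⟨fun h => ⟨h2.1, h⟩, And.right⟩
  · rw [h4, Real.Angle.coe_two_pi, ← Real.Angle.coe_zero] at hcoe
    rw [h4, eq_of_coe_eq h1.1 h1.2 le_rfl Real.two_pi_pos hcoe]
    exact ⟨fun h => absurd h h3.2.not_gt, fun h => absurd h.1 (lt_irrefl _)⟩

/-- The circular order in terms of the angles from an origin. -/
theorem sbtw_iff_ccwAngle_origin (o a b c : Real.Angle) : sbtw a b c ↔
    (ccwAngle o a < ccwAngle o b ∧ ccwAngle o b < ccwAngle o c) ∨
    (ccwAngle o b < ccwAngle o c ∧ ccwAngle o c < ccwAngle o a) ∨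
    (ccwAngle o c < ccwAngle o a ∧ ccwAngle o a < ccwAngle o b) := by
  have key : ∀ b, ccwAngle a b = if ccwAngle o a ≤ ccwAngle o b then
      ccwAngle o b - ccwAngle o a else ccwAngle o b - ccwAngle o a + 2 * Real.pi := by
    intro b
    have ha := ccwAngle_nonneg o a
    have ha' := ccwAngle_lt o a
    have hb := ccwAngle_nonneg o b
    have hb' := ccwAngle_lt o b
    split_ifs with h
    · refine ccwAngle_eq_of_coe (by linarith) (by linarith) ?_
      rw [Real.Angle.coe_sub, coe_ccwAngle, coe_ccwAngle]; abel
    · refine ccwAngle_eq_of_coe (by linarith) (by linarith) ?_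
      rw [Real.Angle.coe_add, Real.Angle.coe_sub, coe_ccwAngle, coe_ccwAngle,
        Real.Angle.coe_two_pi]; abel
  have hb := ccwAngle_nonneg o b
  have hc := ccwAngle_nonneg o c
  have ha' := ccwAngle_lt o a
  have hb' := ccwAngle_lt o b
  have hc' := ccwAngle_lt o c
  rw [sbtw_iff_ccwAngle, key b, key c]
  constructor
  · rintro ⟨h1, h2⟩
    split_ifs at h1 h2 with h3 h4 h4
    · exact Or.inl ⟨by linarith, by linarith⟩
    · exact Or.inr (Or.inr ⟨by linarith, by linarith⟩)
    · linarith
    · exact Or.inr (Or.inl ⟨by linarith, by linarith⟩)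
  · rintro (⟨h1, h2⟩ | ⟨h1, h2⟩ | ⟨h1, h2⟩)
    · rw [if_pos h1.le, if_pos (h1.trans h2).le]
      exact ⟨by linarith, by linarith⟩
    · rw [if_neg (h1.trans h2).not_ge, if_neg h2.not_ge]
      exact ⟨by linarith, by linarith⟩
    · rw [if_pos h2.le, if_neg h1.not_ge]
      exact ⟨by linarith, by linarith⟩

theorem norm_smul_unitVec_arg (r : ℝ × ℝ) :
    r = ‖Complex.mk r.1 r.2‖ • unitVec (Complex.mk r.1 r.2).arg := by
  refine Prod.ext ?_ ?_
  · simp [unitVec, Complex.norm_mul_cos_arg]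
  · simp [unitVec, Complex.norm_mul_sin_arg]

theorem unitVec_eq_of_coe_eq {x y : ℝ} (h : (x : Real.Angle) = y) : unitVec x = unitVec y := by
  rw [unitVec, unitVec, ← Real.Angle.cos_coe, ← Real.Angle.sin_coe, h, Real.Angle.cos_coe,
    Real.Angle.sin_coe]

theorem norm_mk_pos {r : ℝ × ℝ} (h : r ≠ 0) : 0 < ‖Complex.mk r.1 r.2‖ := by
  rw [norm_pos_iff]
  intro h0
  exact h (Prod.ext (congrArg Complex.re h0) (congrArg Complex.im h0))

theorem toPlane_ne_zero {p : ℤ × ℤ} (h : p ≠ 0) : toPlane p ≠ 0 := by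
  intro h0
  apply h
  have h1 := congrArg Prod.fst h0
  have h2 := congrArg Prod.snd h0
  simp only [toPlane, Prod.fst_zero, Prod.snd_zero, Int.cast_eq_zero] at h1 h2
  exact Prod.ext h1 h2

/-! ### Ray matchings in polar coordinates -/

namespace Dimer

variable {E : Type*} [Fintype E] {D : Dimer E}

theorem winding_zigzagStep (D : Dimer E) (e : E) :
    D.winding (D.zigzagStep e) = D.winding e := by
  classical
  rw [winding, winding]
  congr 1
  ext x
  simp only [Finset.mem_filter, Finset.mem_univ, true_and]
  exact Equiv.Perm.sameCycle_apply_left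

theorem dirAfter_zigzagStep (D : Dimer E) (e : E) :
    D.dirAfter (D.zigzagStep e) = D.dirAfter e := by
  rw [dirAfter, dirAfter, winding_zigzagStep]

/-- The path just before `e` is the same at both ends; this is why the white and the black end
choose the same edge. -/
theorem dirAfter_rotB_inv (D : Dimer E) (e : E) :
    D.dirAfter (D.rotB⁻¹ e) = D.dirBefore e := by
  rw [← zigzagStep_rotW_inv, dirAfter_zigzagStep, dirBefore]

theorem angleOrdered_ccwAngle {rot : Equiv.Perm E} (h : D.NodesProperlyOrdered rot)
    (hrot : ∀ e, D.dirAfter (rot⁻¹ e) = D.dirBefore e) (o : Real.Angle) :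
    AngleOrdered rot (fun e => ccwAngle o (D.dirAfter e)) where
  inj e f hef heq := h.2.1 e f hef (ccwAngle_injective heq)
  ne e heq := by
    have h1 := ccwAngle_injective heq
    apply h.2.2.2 (rot e)
    rw [← hrot, perm_inv_apply_self, h1]
  desc e f hef hlt := by
    have h1 := h.2.2.1 e f hef
    rw [sbtw_iff_ccwAngle_origin o] at h1
    push Not at h1
    refine ⟨?_, ?_⟩
    · by_contra! hc
      exact absurd hlt (h1.2.1 hc).not_gt
    · by_contra! hc
      exact absurd hc (h1.2.2 hlt).not_gt

/-- The windings in polar coordinates, seen from a ray. -/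
noncomputable def polarChart (hD : D.ProperlyOrdered) (r : ℝ × ℝ) (hr : D.IsRay r) :
    PolarChart D where
  base := (Complex.mk r.1 r.2).arg
  t e := ccwAngle (direction r) (D.dirAfter e)
  len e := open Classical in ((Finset.univ.filter (D.zigzagStep.SameCycle e)).card : ℝ)⁻¹ *
    ‖Complex.mk (toPlane (D.winding e)).1 (toPlane (D.winding e)).2‖
  t_pos e := ccwAngle_pos (hr.2 e)
  t_lt e := ccwAngle_lt _ _
  len_pos e := by
    refine mul_pos (inv_pos.2 (Nat.cast_pos.2 (Finset.card_pos.2 ⟨e, ?_⟩)))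
      (norm_mk_pos (toPlane_ne_zero (hD.1.1 e)))
    simp [Equiv.Perm.SameCycle.refl]
  meanWinding_eq e := by
    rw [meanWinding, mul_smul]
    congr 1
    · conv_lhs => rw [norm_smul_unitVec_arg (toPlane (D.winding e))]
      congr 1
      refine unitVec_eq_of_coe_eq ?_
      rw [Real.Angle.coe_add, coe_ccwAngle]
      change direction (toPlane (D.winding e)) = direction r + (D.dirAfter e - direction r)
      rw [add_sub_cancel]; rfl
  t_zigzagStep e := by rw [dirAfter_zigzagStep]
  rotW_ordered := angleOrdered_ccwAngle hD.1 (fun _ => rfl) _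
  rotB_ordered := angleOrdered_ccwAngle hD.2 D.dirAfter_rotB_inv _

theorem polarChart_t (hD : D.ProperlyOrdered) {r : ℝ × ℝ} (hr : D.IsRay r) (e : E) :
    (polarChart hD r hr).t e = ccwAngle (direction r) (D.dirAfter e) := rfl

theorem polarChart_t_rotW_inv (hD : D.ProperlyOrdered) {r : ℝ × ℝ} (hr : D.IsRay r) (e : E) :
    (polarChart hD r hr).t (D.rotW⁻¹ e) = ccwAngle (direction r) (D.dirBefore e) := rfl

/-- Being chosen means that the path after `e` has the smallest and the path before `e` the largest
angle from the ray. By proper ordering this happens exactly at the descent, a condition that no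
longer mentions the node. -/
theorem isChosen_iff {r : ℝ × ℝ} (hr : D.IsRay r) {rot : Equiv.Perm E}
    (h : D.NodesProperlyOrdered rot) (hrot : ∀ e, D.dirAfter (rot⁻¹ e) = D.dirBefore e) (e : E) :
    D.IsChosen rot r e ↔ ccwAngle (direction r) (D.dirAfter e) <
      ccwAngle (direction r) (D.dirBefore e) := by
  have hpos : ∀ f, 0 < ccwAngle (direction r) (D.dirAfter f) := fun f => ccwAngle_pos (hr.2 f)
  have hself : ccwAngle (direction r) (direction r) = 0 := ccwAngle_self _
  have key : D.IsChosen rot r e ↔ ∀ f, rot.SameCycle e f →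
      ccwAngle (direction r) (D.dirAfter e) ≤ ccwAngle (direction r) (D.dirAfter f) ∧
      ccwAngle (direction r) (D.dirAfter f) ≤ ccwAngle (direction r) (D.dirBefore e) := by
    refine forall_congr' fun f => imp_congr_right fun _ => ?_
    have hf := hpos f
    have h1 : ¬ sbtw (direction r) (D.dirAfter f) (D.dirAfter e) ↔
        ccwAngle (direction r) (D.dirAfter e) ≤ ccwAngle (direction r) (D.dirAfter f) := by
      rw [sbtw_iff_ccwAngle, not_and, not_lt]
      exact ⟨fun h => h hf, fun h _ => h⟩
    have h2 : ¬ sbtw (D.dirBefore e) (D.dirAfter f) (direction r) ↔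
        ccwAngle (direction r) (D.dirAfter f) ≤ ccwAngle (direction r) (D.dirBefore e) := by
      rw [sbtw_cyclic, sbtw_iff_ccwAngle, not_and, not_lt]
      exact ⟨fun h => h (hpos _), fun h _ => h⟩
    rw [h1, h2]
  have ho := angleOrdered_ccwAngle h hrot (direction r)
  rw [key]
  constructor
  · intro hc
    have h1 := (hc (rot⁻¹ e) (Equiv.Perm.sameCycle_symm_apply_right.2
      (Equiv.Perm.SameCycle.refl _ _))).1
    rw [hrot] at h1
    exact lt_of_le_of_ne h1 fun heq => h.2.2.2 e (ccwAngle_injective heq).symm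
  · intro hlt f hf
    have h1 := ho.desc (rot⁻¹ e) f (Equiv.Perm.sameCycle_symm_apply_left.2 hf)
    simp only [perm_apply_inv_self, hrot] at h1
    exact h1 hlt

theorem mem_rayMatching_iff (hD : D.ProperlyOrdered) {r : ℝ × ℝ} (hr : D.IsRay r) (e : E) :
    e ∈ D.rayMatching r ↔ ccwAngle (direction r) (D.dirAfter e) <
      ccwAngle (direction r) (D.dirBefore e) := by
  change D.IsChosen D.rotW r e ∨ D.IsChosen D.rotB r e ↔ _
  rw [isChosen_iff hr hD.1 fun _ => rfl, isChosen_iff hr hD.2 D.dirAfter_rotB_inv, or_self]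

open Classical in
/-- The indicator function of a set of edges. -/
noncomputable def edgeIndicator (M : Set E) (e : E) : ℝ := if e ∈ M then 1 else 0

theorem edgeIndicator_rayMatching (hD : D.ProperlyOrdered) {r : ℝ × ℝ} (hr : D.IsRay r) :
    edgeIndicator (D.rayMatching r) = (polarChart hD r hr).baseMatching := by
  funext e
  rw [edgeIndicator, PolarChart.baseMatching]
  simp only [mem_rayMatching_iff hD hr]
  rfl

/-- Whether `s` chooses `e` depends only on the cyclic order of `s` and the two strands at `e`.
Cutting the circle at `r` turns this into the flip formula. -/
theorem edgeIndicator_rayMatching_eq_matching (hD : D.ProperlyOrdered) {r s : ℝ × ℝ}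
    (hr : D.IsRay r) (hs : D.IsRay s) : edgeIndicator (D.rayMatching s) =
      (polarChart hD r hr).matching (ccwAngle (direction r) (direction s)) := by
  classical
  funext e
  have h1 : e ∈ D.rayMatching s ↔ sbtw (direction s) (D.dirAfter e) (D.dirBefore e) := by
    rw [mem_rayMatching_iff hD hs, sbtw_iff_ccwAngle]
    exact ⟨fun h => ⟨ccwAngle_pos (hs.2 e), h⟩, And.right⟩
  rw [PolarChart.matching_apply, edgeIndicator]
  simp only [h1, sbtw_iff_ccwAngle_origin (direction r), polarChart_t_rotW_inv]
  simp only [polarChart_t]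
  have n1 : ccwAngle (direction r) (D.dirAfter e) ≠ ccwAngle (direction r) (direction s) :=
    fun h => hs.2 e (ccwAngle_injective h).symm
  have n2 : ccwAngle (direction r) (D.dirBefore e) ≠ ccwAngle (direction r) (direction s) :=
    fun h => hs.2 _ (ccwAngle_injective h).symm
  have n3 : ccwAngle (direction r) (D.dirBefore e) ≠ ccwAngle (direction r) (D.dirAfter e) :=
    fun h => hD.1.2.2.2 e (ccwAngle_injective h)
  rcases n1.lt_or_gt with n1 | n1 <;> rcases n2.lt_or_gt with n2 | n2 <;>
    rcases n3.lt_or_gt with n3 | n3 <;>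
    simp [n1, n2, n3, n1.not_gt, n2.not_gt, n3.not_gt] <;> linarith

end Dimer

/-! ### Perfect matchings and their positions -/

theorem nodeSumsOne_edgeIndicator_iff {E : Type*} [Fintype E] (rot : Equiv.Perm E) (M : Set E) :
    NodeSumsOne rot (Dimer.edgeIndicator M) ↔
      ∀ w : Quotient (Equiv.Perm.SameCycle.setoid rot), ∃! e, e ∈ M ∧ Quotient.mk _ e = w := by
  classical
  have h1 : ∀ e, ∑ f with rot.SameCycle e f, Dimer.edgeIndicator M f =
      ((Finset.univ.filter fun f => f ∈ M ∧ rot.SameCycle e f).card : ℝ) := by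
    intro e
    simp only [Dimer.edgeIndicator, ← Finset.sum_filter, Finset.filter_filter]
    rw [Finset.sum_const, nsmul_eq_mul, mul_one]
    congr 2
    ext f
    simp only [Finset.mem_filter, and_comm]
  have h2 : ∀ e, (∑ f with rot.SameCycle e f, Dimer.edgeIndicator M f = 1 ↔
      ∃! f, f ∈ M ∧ (Quotient.mk (Equiv.Perm.SameCycle.setoid rot) f) = Quotient.mk _ e) := by
    intro e
    rw [h1, Nat.cast_eq_one, Finset.card_eq_one]
    have h3 : ∀ f, (f ∈ M ∧ (Quotient.mk (Equiv.Perm.SameCycle.setoid rot) f) = Quotient.mk _ e) ↔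
        f ∈ Finset.univ.filter fun f => f ∈ M ∧ rot.SameCycle e f := by
      intro f
      rw [Quotient.eq, Finset.mem_filter]
      exact ⟨fun h => ⟨Finset.mem_univ _, h.1, h.2.symm⟩, fun h => ⟨h.2.1, h.2.2.symm⟩⟩
    simp only [h3]
    constructor
    · rintro ⟨a, ha⟩
      exact ⟨a, by simp only [ha, Finset.mem_singleton], fun y hy => by
        simpa only [ha, Finset.mem_singleton] using hy⟩
    · rintro ⟨a, ha, hu⟩
      exact ⟨a, Finset.eq_singleton_iff_unique_mem.2 ⟨ha, hu⟩⟩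
  constructor
  · intro h w
    obtain ⟨e, rfl⟩ := Quotient.exists_rep w
    exact (h2 e).1 (by convert h e)
  · intro h e
    convert (h2 e).2 (h _)

/-- The position in the toric diagram of a total displacement. -/
noncomputable def crossingMap (u v : ℤ × ℤ) : (ℝ × ℝ) →ₗ[ℝ] (ℝ × ℝ) where
  toFun d := (wedge d (toPlane u), wedge d (toPlane v))
  map_add' a b := by
    ext <;> simp only [wedge, Prod.fst_add, Prod.snd_add] <;> ring
  map_smul' k a := by
    ext <;> simp only [wedge, Prod.smul_fst, Prod.smul_snd, smul_eq_mul, RingHom.id_apply] <;> ring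

theorem wedge_crossingMap (u v : ℤ × ℤ) (a b : ℝ × ℝ) :
    wedge (crossingMap u v a) (crossingMap u v b) = ((wedge u v : ℤ) : ℝ) * wedge a b := by
  simp only [crossingMap, LinearMap.coe_mk, AddHom.coe_mk, wedge, toPlane]
  push_cast
  ring

theorem crossingMap_injective {u v : ℤ × ℤ} (h : wedge u v = 1 ∨ wedge u v = -1) :
    Function.Injective (crossingMap u v) := by
  rw [injective_iff_map_eq_zero]
  intro a ha
  have h0 : ((wedge u v : ℤ) : ℝ) ≠ 0 := by
    rcases h with h | h <;> rw [h] <;> norm_num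
  have key : ∀ b, wedge a b = 0 := by
    intro b
    have := wedge_crossingMap u v a b
    rw [ha] at this
    refine (mul_eq_zero.1 (this.symm.trans ?_)).resolve_left h0
    simp [wedge]
  have k1 := key (0, 1)
  have k2 := key (1, 0)
  simp only [wedge, mul_zero, mul_one, sub_zero, zero_sub, neg_eq_zero] at k1 k2
  exact Prod.ext k1 k2

namespace Dimer

variable {E : Type*} [Fintype E] {D : Dimer E}

theorem isPerfectMatching_iff (M : Set E) :
    D.IsPerfectMatching M ↔ D.IsFractional (edgeIndicator M) := by
  constructor
  · intro h
    refine ⟨fun e => ?_, (nodeSumsOne_edgeIndicator_iff _ M).2 h.1,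
      (nodeSumsOne_edgeIndicator_iff _ M).2 h.2⟩
    rw [edgeIndicator]
    split_ifs <;> norm_num
  · intro h
    exact ⟨(nodeSumsOne_edgeIndicator_iff _ M).1 h.white,
      (nodeSumsOne_edgeIndicator_iff _ M).1 h.black⟩

theorem edgeIndicator_injective : Function.Injective (edgeIndicator : Set E → E → ℝ) := by
  intro M M' h
  ext e
  have := congrFun h e
  simp only [edgeIndicator] at this
  by_cases h1 : e ∈ M <;> by_cases h2 : e ∈ M' <;> simp_all

theorem toPlane_exponent (D : Dimer E) (u v : ℤ × ℤ) (e : E) :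
    toPlane (D.exponent u v e) = crossingMap u v (D.planeDisp e) := by
  simp only [crossingMap, LinearMap.coe_mk, AddHom.coe_mk, exponent, crossing, planeDisp, toPlane,
    wedge]
  push_cast
  rfl

theorem position_eq (D : Dimer E) (u v : ℤ × ℤ) (M : Set E) :
    D.position u v M = crossingMap u v (D.totalDisp (edgeIndicator M)) := by
  classical
  rw [position, toPlane_sum, totalDisp, map_sum, Finset.sum_filter]
  refine Finset.sum_congr rfl fun e _ => ?_
  rw [toPlane_exponent, map_smul, edgeIndicator]
  split_ifs <;> simp

theorem isPerfectMatching_rayMatching (hD : D.ProperlyOrdered) {r : ℝ × ℝ} (hr : D.IsRay r) :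
    D.IsPerfectMatching (D.rayMatching r) := by
  rw [isPerfectMatching_iff, edgeIndicator_rayMatching hD hr]
  exact (polarChart hD r hr).isFractional_baseMatching

theorem IsPerfectMatching.nonempty_equiv {M : Set E} (h : D.IsPerfectMatching M) :
    Nonempty (D.White ≃ D.Black) := by
  let f : M ≃ D.White := Equiv.ofBijective (fun e => D.white e.1)
    ⟨fun e f hef => Subtype.ext ((h.1 _).unique ⟨e.2, rfl⟩ ⟨f.2, hef.symm⟩), fun w => by
      obtain ⟨e, he, -⟩ := h.1 w
      exact ⟨⟨e, he.1⟩, he.2⟩⟩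
  let g : M ≃ D.Black := Equiv.ofBijective (fun e => D.black e.1)
    ⟨fun e f hef => Subtype.ext ((h.2 _).unique ⟨e.2, rfl⟩ ⟨f.2, hef.symm⟩), fun w => by
      obtain ⟨e, he, -⟩ := h.2 w
      exact ⟨⟨e, he.1⟩, he.2⟩⟩
  exact ⟨f.symm.trans g⟩

/-- Among the perfect matchings, the matching of a ray is the only extremal one in the direction
of the ray. -/
theorem IsPerfectMatching.support (hD : D.ProperlyOrdered) {r : ℝ × ℝ} (hr : D.IsRay r)
    {M : Set E} (hM : D.IsPerfectMatching M) :
    0 ≤ wedge r (D.totalDisp (edgeIndicator M) - D.totalDisp (edgeIndicator (D.rayMatching r))) ∧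
    (wedge r (D.totalDisp (edgeIndicator M) - D.totalDisp (edgeIndicator (D.rayMatching r))) = 0 →
      M = D.rayMatching r) := by
  rcases isEmpty_or_nonempty E with hE | hE
  · have : M = D.rayMatching r := by
      ext e
      exact isEmptyElim e
    rw [this, sub_self]
    simp [wedge]
  · have h := (polarChart hD r hr).support ((isPerfectMatching_iff M).1 hM)
    rw [← edgeIndicator_rayMatching hD hr] at h
    have hv : r = ‖Complex.mk r.1 r.2‖ • (polarChart hD r hr).vec 0 := by
      rw [PolarChart.vec, add_zero]
      exact norm_smul_unitVec_arg r
    have hpos := norm_mk_pos hr.1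
    rw [congrArg wedge hv, wedge_smul_left]
    refine ⟨mul_nonneg hpos.le h.1, fun h0 => ?_⟩
    exact edgeIndicator_injective (h.2 ((mul_eq_zero.1 h0).resolve_left hpos.ne'))

/-! ### Coefficients of the Kasteleyn determinant -/

section Determinant

variable (u v : ℤ × ℤ) (c : E → ℂ) (β : D.White ≃ D.Black)

-- A permutation together with a choice of one edge for each matrix entry it uses is a perfect
-- matching; its term sits at the exponent of the matching.
open Classical in
theorem coeff_kasteleynDet (p : ℤ × ℤ) : (D.kasteleynDet u v c β).coeff p =
    ∑ σ : Equiv.Perm D.White, ∑ f ∈ Fintype.piFinset fun x =>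
      Finset.univ.filter (fun e => D.white e = σ x ∧ D.black e = β x),
      if ∑ x, D.exponent u v (f x) = p then
        ((Equiv.Perm.sign σ : ℤ) : ℂ) * ∏ x, c (f x) else 0 := by
  have hprod : ∀ f : D.White → E, ∏ x, AddMonoidAlgebra.single (D.exponent u v (f x)) (c (f x)) =
      AddMonoidAlgebra.single (∑ x, D.exponent u v (f x)) (∏ x, c (f x)) := by
    intro f
    induction (Finset.univ : Finset D.White) using Finset.induction_on with
    | empty => rfl
    | insert a s ha ih =>
      rw [Finset.prod_insert ha, Finset.prod_insert ha, Finset.sum_insert ha, ih,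
        AddMonoidAlgebra.single_mul_single]
  rw [kasteleynDet, Matrix.det_apply, AddMonoidAlgebra.coeff_sum, Finsupp.finsetSum_apply]
  refine Finset.sum_congr rfl fun σ _ => ?_
  simp only [Matrix.submatrix_apply, id_eq, kasteleyn, Matrix.of_apply]
  rw [Finset.prod_univ_sum, Finset.smul_sum, AddMonoidAlgebra.coeff_sum, Finsupp.finsetSum_apply]
  refine Finset.sum_congr (by congr!) fun f _ => ?_
  rw [hprod]
  rcases Int.units_eq_one_or (Equiv.Perm.sign σ) with h | h <;> rw [h] <;>
    simp [AddMonoidAlgebra.coeff_single, Finsupp.single_apply] <;> split_ifs <;> simp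

variable {β}

theorem isPerfectMatching_range {σ : Equiv.Perm D.White} {f : D.White → E}
    (h : ∀ x, D.white (f x) = σ x ∧ D.black (f x) = β x) :
    D.IsPerfectMatching (Set.range f) := by
  constructor
  · intro w
    refine ⟨f (σ⁻¹ w), ⟨⟨_, rfl⟩, by rw [(h _).1, perm_apply_inv_self]⟩, ?_⟩
    rintro _ ⟨⟨x, rfl⟩, hx⟩
    rw [← hx, (h x).1, perm_inv_apply_self]
  · intro b
    refine ⟨f (β.symm b), ⟨⟨_, rfl⟩, by rw [(h _).2, Equiv.apply_symm_apply]⟩, ?_⟩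
    rintro _ ⟨⟨x, rfl⟩, hx⟩
    rw [← hx, (h x).2, Equiv.symm_apply_apply]

theorem position_range {σ : Equiv.Perm D.White} {f : D.White → E}
    (h : ∀ x, D.white (f x) = σ x ∧ D.black (f x) = β x) :
    D.position u v (Set.range f) = toPlane (∑ x, D.exponent u v (f x)) := by
  classical
  have hinj : Function.Injective f := fun x y hxy => β.injective (by
    rw [← (h x).2, ← (h y).2, hxy])
  rw [position]
  congr 1
  rw [← Finset.sum_image (s := Finset.univ) (f := D.exponent u v) (g := f)
    fun x _ y _ hxy => hinj hxy]
  refine Finset.sum_congr ?_ fun _ _ => rfl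
  ext e
  simp

theorem exists_isPerfectMatching_of_coeff_ne_zero {p : ℤ × ℤ}
    (hp : (D.kasteleynDet u v c β).coeff p ≠ 0) :
    ∃ M, D.IsPerfectMatching M ∧ D.position u v M = toPlane p := by
  classical
  rw [coeff_kasteleynDet] at hp
  obtain ⟨σ, -, hσ⟩ := Finset.exists_ne_zero_of_sum_ne_zero hp
  obtain ⟨f, hf, hfp⟩ := Finset.exists_ne_zero_of_sum_ne_zero hσ
  have hf' : ∀ x, D.white (f x) = σ x ∧ D.black (f x) = β x := fun x => by
    simpa using Fintype.mem_piFinset.1 hf x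
  refine ⟨Set.range f, isPerfectMatching_range hf', ?_⟩
  rw [position_range u v hf']
  congr 1
  by_contra hne
  exact hfp (if_neg hne)

/-- No cancellation is possible: only one pair of permutation and edge choice contributes to this
exponent. -/
theorem exists_coeff_ne_zero_of_unique (hc : ∀ e, c e ≠ 0) {M : Set E}
    (hM : D.IsPerfectMatching M)
    (hu : ∀ M', D.IsPerfectMatching M' → D.position u v M' = D.position u v M → M' = M) :
    ∃ p, (D.kasteleynDet u v c β).coeff p ≠ 0 ∧ toPlane p = D.position u v M := by
  classical
  choose g hg hgu using hM.2
  have hinj : Function.Injective fun x => D.white (g (β x)) := fun x y hxy => by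
    have h1 : g (β x) = g (β y) := (hM.1 (D.white (g (β y)))).unique ⟨(hg _).1, hxy⟩
      ⟨(hg _).1, rfl⟩
    apply β.injective
    rw [← (hg (β x)).2, h1, (hg (β y)).2]
  let σ : Equiv.Perm D.White := Equiv.ofBijective _ (Finite.injective_iff_bijective.1 hinj)
  have hf : ∀ x, D.white (g (β x)) = σ x ∧ D.black (g (β x)) = β x := fun x => ⟨rfl, (hg _).2⟩
  have hrange : Set.range (fun x => g (β x)) = M := by
    ext e
    constructor
    · rintro ⟨x, rfl⟩
      exact (hg _).1
    · intro he
      refine ⟨β.symm (D.black e), ?_⟩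
      simp only [Equiv.apply_symm_apply]
      exact (hgu _ e ⟨he, rfl⟩).symm
  have hpos := position_range u v hf
  rw [hrange] at hpos
  refine ⟨∑ x, D.exponent u v (g (β x)), ?_, hpos.symm⟩
  have huniq : ∀ (σ' : Equiv.Perm D.White) (f' : D.White → E),
      (∀ x, D.white (f' x) = σ' x ∧ D.black (f' x) = β x) →
      ∑ x, D.exponent u v (f' x) = ∑ x, D.exponent u v (g (β x)) →
      f' = fun x => g (β x) := by
    intro σ' f' hf' hsum
    have h1 := hu _ (isPerfectMatching_range hf') (by
      rw [position_range u v hf', hsum, hpos])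
    funext x
    refine hgu _ _ ⟨?_, (hf' x).2⟩
    rw [← h1]
    exact ⟨x, rfl⟩
  rw [coeff_kasteleynDet, Finset.sum_eq_single σ, Finset.sum_eq_single fun x => g (β x)]
  · rw [if_pos rfl]
    refine mul_ne_zero ?_ (Finset.prod_ne_zero_iff.2 fun x _ => hc _)
    rcases Int.units_eq_one_or (Equiv.Perm.sign σ) with h | h <;> rw [h] <;> norm_num
  · intro f' hf' hne
    have hf'' : ∀ x, D.white (f' x) = σ x ∧ D.black (f' x) = β x := fun x => by
      simpa using Fintype.mem_piFinset.1 hf' x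
    exact if_neg fun hsum => hne (huniq σ f' hf'' hsum)
  · intro hn
    exact absurd (Fintype.mem_piFinset.2 fun x => by simpa using hf x) hn
  · intro σ' _ hne
    refine Finset.sum_eq_zero fun f' hf' => if_neg fun hsum => hne ?_
    have hf'' : ∀ x, D.white (f' x) = σ' x ∧ D.black (f' x) = β x := fun x => by
      simpa using Fintype.mem_piFinset.1 hf' x
    have h1 := huniq σ' f' hf'' hsum
    ext x
    rw [← (hf'' x).1, h1]
    rfl
  · intro hn
    exact absurd (Finset.mem_univ σ) hn

end Determinant

end Dimer

/-! ### Extreme points and generic directions -/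

/-- A point of a set that is the only minimum of a linear functional is an extreme point of the
convex hull. -/
theorem mem_extremePoints_convexHull_of_lt {V : Type*} [AddCommGroup V] [Module ℝ V] {s : Set V}
    {p : V} (hp : p ∈ s) (φ : V →ₗ[ℝ] ℝ) (h : ∀ q ∈ s, q ≠ p → φ p < φ q) :
    p ∈ (convexHull ℝ s).extremePoints ℝ := by
  have hcomb : ∀ x y : V, (x = p ∨ φ p < φ x) → (y = p ∨ φ p < φ y) → ∀ a b : ℝ, 0 < a → 0 < b →
      a + b = 1 → x ≠ p → φ p < φ (a • x + b • y) := by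
    intro x y hx hy a b ha hb hab hxp
    have h1 := mul_lt_mul_of_pos_left (hx.resolve_left hxp) ha
    have h2 : b * φ p ≤ b * φ y := by
      refine mul_le_mul_of_nonneg_left ?_ hb.le
      rcases hy with rfl | hy
      exacts [le_rfl, hy.le]
    have h3 : φ p = a * φ p + b * φ p := by rw [← add_mul, hab, one_mul]
    rw [map_add, map_smul, map_smul, smul_eq_mul, smul_eq_mul]
    linarith
  have hsub : convexHull ℝ s ⊆ {x | x = p ∨ φ p < φ x} := by
    refine convexHull_min (fun q hq => ?_) (convex_iff_forall_pos.2 ?_)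
    · by_cases hqp : q = p
      · exact Or.inl hqp
      · exact Or.inr (h q hq hqp)
    · intro x hx y hy a b ha hb hab
      by_cases hxp : x = p
      · by_cases hyp : y = p
        · left
          rw [hxp, hyp, ← add_smul, hab, one_smul]
        · right
          rw [add_comm]
          exact hcomb y x hy hx b a hb ha (by rw [add_comm, hab]) hyp
      · exact Or.inr (hcomb x y hx hy a b ha hb hab hxp)
  refine mem_extremePoints.2 ⟨subset_convexHull ℝ s hp, fun x hx y hy hxy => ?_⟩
  obtain ⟨a, b, ha, hb, hab, hpab⟩ := hxy
  constructor
  · by_contra hxp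
    have := hcomb x y (hsub hx) (hsub hy) a b ha hb hab hxp
    rw [hpab] at this
    exact lt_irrefl _ this
  · by_contra hyp
    have := hcomb y x (hsub hy) (hsub hx) b a hb ha (by rw [add_comm, hab]) hyp
    rw [add_comm, hpab] at this
    exact lt_irrefl _ this

/-- Along a parabola, a nonzero linear form is a nonzero polynomial of degree at most two. A line
segment would not do, since it could lie in the forbidden line. -/
theorem finite_wedge_parabola_eq_zero {w : ℝ × ℝ} (hw : w ≠ 0) (a : ℝ × ℝ) :
    {τ : ℝ | wedge w (a + (τ, τ ^ 2)) = 0}.Finite := by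
  classical
  let q : Polynomial ℝ := Polynomial.C w.1 * Polynomial.X ^ 2 + Polynomial.C (-w.2) * Polynomial.X +
    Polynomial.C (w.1 * a.2 - w.2 * a.1)
  have hq : q ≠ 0 := by
    intro h
    have h2 := congrArg (fun q => Polynomial.coeff q 2) h
    have h1 := congrArg (fun q => Polynomial.coeff q 1) h
    simp [q, Polynomial.coeff_C] at h1 h2
    exact hw (Prod.ext h2 h1)
  refine (Polynomial.finite_setOfPred_isRoot hq).subset fun τ hτ => ?_
  change q.eval τ = 0
  change wedge w (a + (τ, τ ^ 2)) = 0 at hτ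
  simp only [q, Polynomial.eval_add, Polynomial.eval_mul, Polynomial.eval_C, Polynomial.eval_pow,
    Polynomial.eval_X]
  simp only [wedge, Prod.fst_add, Prod.snd_add] at hτ
  linarith

/-! ### Corners of the toric diagram and their cyclic order -/

namespace Dimer

variable {E : Type*} [Fintype E] {D : Dimer E}

theorem direction_ne_of_wedge_ne_zero {r w : ℝ × ℝ} (h : wedge w r ≠ 0) :
    direction r ≠ direction w := by
  intro heq
  apply h
  rw [norm_smul_unitVec_arg r, norm_smul_unitVec_arg w, unitVec_eq_of_coe_eq heq,
    wedge_smul_left, wedge_smul_right, wedge_unitVec, sub_self, Real.sin_zero, mul_zero, mul_zero]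

/-- The rays are dense. -/
theorem exists_isRay_mem (hD : D.ProperlyOrdered) {U : Set (ℝ × ℝ)} (hU : IsOpen U) {a : ℝ × ℝ}
    (ha : a ∈ U) : ∃ r ∈ U, D.IsRay r := by
  have hcont : Continuous fun τ : ℝ => a + (τ, τ ^ 2) := by fun_prop
  have hmem : (fun τ : ℝ => a + (τ, τ ^ 2)) ⁻¹' U ∈ nhds (0 : ℝ) :=
    (hU.preimage hcont).mem_nhds (by
      change a + ((0 : ℝ), (0 : ℝ) ^ 2) ∈ U
      rwa [zero_pow two_ne_zero, Prod.mk_zero_zero, add_zero])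
  -- The first point excludes the zero vector; the other sets exclude the lines through the
  -- windings.
  have hbad : ({-a.1} ∪ ⋃ e, {τ : ℝ | wedge (toPlane (D.winding e)) (a + (τ, τ ^ 2)) = 0}).Finite :=
    (Set.finite_singleton _).union (Set.finite_iUnion fun e =>
      finite_wedge_parabola_eq_zero (toPlane_ne_zero (hD.1.1 e)) a)
  obtain ⟨τ, hτU, hτ⟩ := ((infinite_of_mem_nhds 0 hmem).sdiff hbad).nonempty
  refine ⟨_, hτU, fun h0 => hτ (Or.inl ?_), fun e =>
    direction_ne_of_wedge_ne_zero fun h0 => hτ (Or.inr (Set.mem_iUnion.2 ⟨e, h0⟩))⟩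
  have h1 := congrArg Prod.fst h0
  simp only [Prod.fst_add, Prod.fst_zero] at h1
  rw [Set.mem_singleton_iff]
  linarith

/-- The positions of the matchings of the rays. -/
noncomputable def rayPositions (D : Dimer E) (u v : ℤ × ℤ) : Set (ℝ × ℝ) :=
  {p | ∃ r, D.IsRay r ∧ D.position u v (D.rayMatching r) = p}

theorem finite_rayPositions (D : Dimer E) (u v : ℤ × ℤ) : (D.rayPositions u v).Finite := by
  refine (Set.finite_range fun M : Set E => D.position u v M).subset ?_
  rintro _ ⟨r, -, rfl⟩
  exact ⟨_, rfl⟩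

/-- A position outside the hull could be strictly separated from the finitely many ray positions.
Strict separation survives perturbing the functional to one given by a ray, and the matching of that
ray then contradicts its own minimality. -/
theorem position_mem_convexHull (hD : D.ProperlyOrdered) (u v : ℤ × ℤ) {M : Set E}
    (hM : D.IsPerfectMatching M) : D.position u v M ∈ convexHull ℝ (D.rayPositions u v) := by
  by_contra hp
  obtain ⟨φ, k, hφ, hφ'⟩ := geometric_hahn_banach_point_closed (convex_convexHull ℝ _)
    ((D.finite_rayPositions u v).isClosed_convexHull (𝕜 := ℝ)) hp
  -- Every functional on positions is, on displacements, the wedge with a vector; the sign comes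
  -- from moving that vector to the left.
  set r₀ : ℝ × ℝ := -(φ (1, 0) • toPlane u + φ (0, 1) • toPlane v) with hr₀
  have hφd : ∀ d, φ (crossingMap u v d) = wedge r₀ d := by
    intro d
    have : crossingMap u v d =
        wedge d (toPlane u) • ((1 : ℝ), (0 : ℝ)) + wedge d (toPlane v) • ((0 : ℝ), (1 : ℝ)) := by
      ext <;> simp [crossingMap]
    rw [this, map_add, map_smul, map_smul]
    simp only [hr₀, wedge, Prod.fst_neg, Prod.snd_neg, Prod.fst_add, Prod.snd_add, Prod.smul_fst,
      Prod.smul_snd, smul_eq_mul]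
    ring
  let U : Set (ℝ × ℝ) := ⋂ N : {N : Set E // D.position u v N ∈ D.rayPositions u v},
    {r | wedge r (D.totalDisp (edgeIndicator M) - D.totalDisp (edgeIndicator N.1)) < 0}
  have hU : IsOpen U := by
    refine isOpen_iInter_of_finite fun N => isOpen_lt ?_ continuous_const
    unfold wedge
    fun_prop
  have hr₀U : r₀ ∈ U := by
    refine Set.mem_iInter.2 fun N => ?_
    have h1 := hφ.trans (hφ' _ (subset_convexHull ℝ _ N.2))
    rw [position_eq, position_eq, hφd, hφd] at h1
    change wedge r₀ _ < 0
    rw [wedge_sub_right]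
    linarith
  obtain ⟨r, hrU, hr⟩ := exists_isRay_mem hD hU hr₀U
  exact absurd (Set.mem_iInter.1 hrU ⟨D.rayMatching r, r, hr, rfl⟩)
    (hM.support hD hr).1.not_gt

theorem eq_rayMatching_of_position_eq (hD : D.ProperlyOrdered) {u v : ℤ × ℤ}
    (huv : wedge u v = 1 ∨ wedge u v = -1) {r : ℝ × ℝ} (hr : D.IsRay r) {M : Set E}
    (hM : D.IsPerfectMatching M) (h : D.position u v M = D.position u v (D.rayMatching r)) :
    M = D.rayMatching r := by
  rw [position_eq, position_eq] at h
  refine (hM.support hD hr).2 ?_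
  rw [crossingMap_injective huv h, sub_self]
  simp [wedge]

/-- Every exponent that occurs is the position of a perfect matching, hence in the hull; conversely
a ray matching is alone at its position, so its coefficient survives for all nonzero `c`. -/
theorem toricDiagram_eq (hD : D.ProperlyOrdered) {u v : ℤ × ℤ}
    (huv : wedge u v = 1 ∨ wedge u v = -1) {c : E → ℂ} (hc : ∀ e, c e ≠ 0)
    (β : D.White ≃ D.Black) : D.toricDiagram u v c β = convexHull ℝ (D.rayPositions u v) := by
  refine Set.Subset.antisymm (convexHull_min ?_ (convex_convexHull ℝ _)) (convexHull_mono ?_)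
  · rintro _ ⟨p, hp, rfl⟩
    obtain ⟨M, hM, hMp⟩ := exists_isPerfectMatching_of_coeff_ne_zero u v c hp
    rw [← hMp]
    exact position_mem_convexHull hD u v hM
  · rintro _ ⟨r, hr, rfl⟩
    obtain ⟨p, hp, hpr⟩ := exists_coeff_ne_zero_of_unique (β := β) u v c hc
      (isPerfectMatching_rayMatching hD hr)
      fun M' hM' h => eq_rayMatching_of_position_eq hD huv hr hM' h
    exact ⟨p, hp, hpr⟩

theorem extremePoints_convexHull_rayPositions (hD : D.ProperlyOrdered) {u v : ℤ × ℤ}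
    (huv : wedge u v = 1 ∨ wedge u v = -1) :
    (convexHull ℝ (D.rayPositions u v)).extremePoints ℝ = D.rayPositions u v := by
  refine Set.Subset.antisymm extremePoints_convexHull_subset ?_
  rintro _ ⟨r, hr, rfl⟩
  -- The factor `wedge u v` undoes the sign by which `crossingMap` scales wedges, so that `φ`
  -- becomes the wedge with `r` on displacements.
  let φ : (ℝ × ℝ) →ₗ[ℝ] ℝ :=
    { toFun := fun x => ((wedge u v : ℤ) : ℝ) * wedge (crossingMap u v r) x
      map_add' := fun x y => by rw [wedge_add_right, mul_add]
      map_smul' := fun k x => by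
        rw [wedge_smul_right, RingHom.id_apply, smul_eq_mul]; ring }
  have hsq : ((wedge u v : ℤ) : ℝ) * ((wedge u v : ℤ) : ℝ) = 1 := by
    rcases huv with h | h <;> rw [h] <;> norm_num
  have hφ : ∀ d, φ (crossingMap u v d) = wedge r d := fun d => by
    change ((wedge u v : ℤ) : ℝ) * wedge (crossingMap u v r) (crossingMap u v d) = _
    rw [wedge_crossingMap, ← mul_assoc, hsq, one_mul]
  refine mem_extremePoints_convexHull_of_lt ⟨r, hr, rfl⟩ φ ?_
  rintro _ ⟨s, hs, rfl⟩ hne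
  have h := (isPerfectMatching_rayMatching hD hs).support hD hr
  rw [position_eq, position_eq, hφ, hφ, ← sub_pos, ← wedge_sub_right]
  exact lt_of_le_of_ne h.1 fun h0 => hne (by rw [h.2 h0.symm])

/-- Turning the ray from `r` to `s` flips exactly the paths whose directions are passed. -/
theorem position_rayMatching (hD : D.ProperlyOrdered) (u v : ℤ × ℤ) {r s : ℝ × ℝ}
    (hr : D.IsRay r) (hs : D.IsRay s) : D.position u v (D.rayMatching s) =
      D.position u v (D.rayMatching r) + crossingMap u v (PolarChart.windingSum D fun x =>
        ccwAngle (direction r) (D.dirAfter x) < ccwAngle (direction r) (direction s)) := by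
  rw [position_eq, position_eq, edgeIndicator_rayMatching hD hr,
    edgeIndicator_rayMatching_eq_matching hD hr hs, PolarChart.totalDisp_matching_eq, map_add]
  rfl

theorem position_ne_iff (hD : D.ProperlyOrdered) {u v : ℤ × ℤ}
    (huv : wedge u v = 1 ∨ wedge u v = -1) {r s : ℝ × ℝ} (hr : D.IsRay r) (hs : D.IsRay s) :
    D.position u v (D.rayMatching r) ≠ D.position u v (D.rayMatching s) ↔
      (∃ e, sbtw (direction r) (D.dirAfter e) (direction s)) ∧
        ∃ e, sbtw (direction s) (D.dirAfter e) (direction r) := by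
  have h1 : ∀ e, sbtw (direction r) (D.dirAfter e) (direction s) ↔
      ccwAngle (direction r) (D.dirAfter e) < ccwAngle (direction r) (direction s) := fun e => by
    rw [sbtw_iff_ccwAngle]
    exact ⟨And.right, fun h => ⟨ccwAngle_pos (hr.2 e), h⟩⟩
  have h2 : ∀ e, sbtw (direction s) (D.dirAfter e) (direction r) ↔
      0 < ccwAngle (direction r) (direction s) ∧
      ccwAngle (direction r) (direction s) < ccwAngle (direction r) (D.dirAfter e) := fun e => by
    rw [sbtw_cyclic, sbtw_iff_ccwAngle]
  rw [position_rayMatching hD u v hr hs, ne_eq, left_eq_add,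
    map_eq_zero_iff _ (crossingMap_injective huv)]
  simp only [h1, h2]
  constructor
  · intro h
    obtain ⟨x, hx⟩ := PolarChart.exists_mem_of_windingSum_ne_zero h
    refine ⟨⟨x, hx⟩, ?_⟩
    have hpos := (ccwAngle_nonneg _ _).trans_lt hx
    by_contra! hc
    -- If no winding lies in the complementary sector, then all lie in the first one and their sum
    -- vanishes.
    refine h (PolarChart.windingSum_of_forall_mem fun y => lt_of_le_of_ne (hc y hpos) fun heq => ?_)
    exact hs.2 y (ccwAngle_injective heq).symm
  · rintro ⟨⟨x, hx⟩, y, -, hy⟩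
    exact (polarChart hD r hr).windingSum_lt_ne_zero ⟨x, hx⟩ ⟨y, hy⟩
      fun z hz => hs.2 z (ccwAngle_injective hz).symm

theorem wedge_position_pos (hD : D.ProperlyOrdered) {u v : ℤ × ℤ}
    (huv : wedge u v = 1 ∨ wedge u v = -1) {r s t : ℝ × ℝ} (hr : D.IsRay r) (hs : D.IsRay s)
    (ht : D.IsRay t) (hrst : sbtw (direction r) (direction s) (direction t))
    (hrs : D.position u v (D.rayMatching r) ≠ D.position u v (D.rayMatching s))
    (hst : D.position u v (D.rayMatching s) ≠ D.position u v (D.rayMatching t))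
    (htr : D.position u v (D.rayMatching t) ≠ D.position u v (D.rayMatching r)) :
    0 < ((wedge u v : ℤ) : ℝ) *
      wedge (D.position u v (D.rayMatching s) - D.position u v (D.rayMatching r))
        (D.position u v (D.rayMatching t) - D.position u v (D.rayMatching r)) := by
  have hsq : ((wedge u v : ℤ) : ℝ) * ((wedge u v : ℤ) : ℝ) = 1 := by
    rcases huv with h | h <;> rw [h] <;> norm_num
  rw [sbtw_iff_ccwAngle] at hrst
  rw [position_rayMatching hD u v hr hs, ne_eq, left_eq_add,
    map_eq_zero_iff _ (crossingMap_injective huv)] at hrs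
  rw [position_rayMatching hD u v hr ht, ne_eq, add_eq_left,
    map_eq_zero_iff _ (crossingMap_injective huv)] at htr
  rw [position_rayMatching hD u v hr hs, position_rayMatching hD u v hr ht, ne_eq, add_right_inj,
    (crossingMap_injective huv).eq_iff] at hst
  rw [position_rayMatching hD u v hr hs, position_rayMatching hD u v hr ht, add_sub_cancel_left,
    add_sub_cancel_left, wedge_crossingMap, ← mul_assoc, hsq, one_mul]
  exact (polarChart hD r hr).wedge_windingSum_lt_pos hrst.1 hrst.2
    (fun z hz => hs.2 z (ccwAngle_injective hz).symm)
    (fun z hz => ht.2 z (ccwAngle_injective hz).symm) hrs htr hst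

end Dimer

theorem mainTheorem11 {E : Type*} [Fintype E] (D : Dimer E) (hD : D.ProperlyOrdered)
    (u v : ℤ × ℤ) (huv : wedge u v = 1 ∨ wedge u v = -1)
    (c : E → ℂ) (hc : ∀ e, c e ≠ 0) :
    (∀ r, D.IsRay r → D.IsPerfectMatching (D.rayMatching r)) ∧
    Nonempty (D.White ≃ D.Black) ∧
    (∀ β : D.White ≃ D.Black,
      (D.toricDiagram u v c β).extremePoints ℝ =
        {p | ∃ r, D.IsRay r ∧ D.position u v (D.rayMatching r) = p} ∧
      D.toricDiagram u v c β =
        convexHull ℝ {p | ∃ r, D.IsRay r ∧ D.position u v (D.rayMatching r) = p}) ∧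
    (∀ r s, D.IsRay r → D.IsRay s →
      (D.position u v (D.rayMatching r) ≠ D.position u v (D.rayMatching s) ↔
        (∃ e, sbtw (direction r) (D.dirAfter e) (direction s)) ∧
          ∃ e, sbtw (direction s) (D.dirAfter e) (direction r))) ∧
    (∀ r s t, D.IsRay r → D.IsRay s → D.IsRay t →
      sbtw (direction r) (direction s) (direction t) →
      D.position u v (D.rayMatching r) ≠ D.position u v (D.rayMatching s) →
      D.position u v (D.rayMatching s) ≠ D.position u v (D.rayMatching t) →
      D.position u v (D.rayMatching t) ≠ D.position u v (D.rayMatching r) →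
      0 < ((wedge u v : ℤ) : ℝ) *
        wedge (D.position u v (D.rayMatching s) - D.position u v (D.rayMatching r))
          (D.position u v (D.rayMatching t) - D.position u v (D.rayMatching r))) := by
  refine ⟨fun r hr => Dimer.isPerfectMatching_rayMatching hD hr, ?_, fun β => ⟨?_, ?_⟩,
    fun r s hr hs => Dimer.position_ne_iff hD huv hr hs, fun r s t hr hs ht h h1 h2 h3 =>
      Dimer.wedge_position_pos hD huv hr hs ht h h1 h2 h3⟩
  · obtain ⟨r, -, hr⟩ := Dimer.exists_isRay_mem hD isOpen_univ (Set.mem_univ (0 : ℝ × ℝ))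
    exact (Dimer.isPerfectMatching_rayMatching hD hr).nonempty_equiv
  · rw [Dimer.toricDiagram_eq hD huv hc]
    exact Dimer.extremePoints_convexHull_rayPositions hD huv
  · exact Dimer.toricDiagram_eq hD huv hc β
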